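/- Let $\mathbf 2$ be the two-element Boolean algebra. For Heyting algebras $A,B$ let $A+B$ be the coalesced ordinal sum: $B$ is placed on top of $A$ and $\mathbf 1_A$ is identified with $\mathbf 0_B$. For $n\in\{1,2,4,6,8\}$ let $Z_n$ be the $n$-element Heyting algebra generated by one element; thus $Z_1$ is trivial, $Z_2=\mathbf 2$, $Z_4$ is the four-element Boolean algebra, $Z_6$ is the product of the two-element and the three-element chain, and $Z_8$ is the algebra of down-sets of the poset $\{p,q,r,s\}$ whose only strict relations are $q<r$, $p<s$, $q<s$. Let $D$ be the (13-element) algebra of down-sets of the poset $\{l,c,r,x,y\}$ whose only strict relations are $l<x$, $c<x$, $c<y$, $r<y$. The prohibited algebras are $$P_1=Z_6+\mathbf 2,\quad P_2=\mathbf 2+Z_6+\mathbf 2,\quad P_3=\mathbf 2^3+\mathbf 2,\quad P_4=\mathbf 2+\mathbf 2^3+\mathbf 2,\quad P_5=D+\mathbf 2,$$ and $\mathsf W$ is the largest variety of Heyting algebras containing none of $P_1,\dots,P_5$ (up to isomorphism); that is, an algebra belongs to $\mathsf W$ if and only if it belongs to some variety of Heyting algebras containing none of them. A node of an algebra is an element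 comparable with every element, and a nontrivial algebra is nodeless if $\mathbf 0$ and $\mathbf 1$ are its only nodes. Let $A\in\mathsf W$ be finite and subdirectly irreducible. Then: 1. $A$ is projective in $\mathsf W$: for all $A_1,A_2\in\mathsf W$, every surjective homomorphism $h:A_1\to A_2$ and every homomorphism $f:A\to A_2$ there is a homomorphism $g:A\to A_1$ with $hg=f$. 2. $A$ is weakly projective in $\mathsf W$: whenever $A$ is a homomorphic image of some $B\in\mathsf W$, $A$ is isomorphic to a subalgebra of $B$. 3. $A\cong B_0+B_1+\dots+B_m+\mathbf 2$ for some $m\ge 0$, $B_0\in\{Z_1,Z_2,Z_4,Z_8\}$ and $B_1,\dots,B_m\in\{Z_2,Z_4\}$. 4. Moreover, whenever $A\cong B_0+B_1+\dots+B_m+\mathbf 2$ with $m\ge 0$ and all $B_i$ nodeless, $B_0$ is isomorphic to one of $Z_1,Z_2,Z_4,Z_8$, and each $B_i$ with $1\le i\le m$ is isomorphic to $Z_2$ or $Z_4$. -/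

import Mathlib

universe u v

/-! ### Varieties of Heyting algebras -/

/-- Terms in the signature `⟨∧, ∨, →, 0, 1⟩` over countably many variables. -/
inductive HeytingTerm : Type
  | var : ℕ → HeytingTerm
  | bot : HeytingTerm
  | top : HeytingTerm
  | inf : HeytingTerm → HeytingTerm → HeytingTerm
  | sup : HeytingTerm → HeytingTerm → HeytingTerm
  | imp : HeytingTerm → HeytingTerm → HeytingTerm

/-- The value of a term under an assignment of the variables. -/
def HeytingTerm.eval {A : Type u} [HeytingAlgebra A] (x : ℕ → A) : HeytingTerm → A
  | .var n => x n
  | .bot => ⊥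
  | .top => ⊤
  | .inf s t => s.eval x ⊓ t.eval x
  | .sup s t => s.eval x ⊔ t.eval x
  | .imp s t => s.eval x ⇨ t.eval x

/-- The class of all Heyting algebras in which all equations `s ≈ t` with `(s, t) ∈ E` hold. -/
def equationalClass (E : Set (HeytingTerm × HeytingTerm)) : Set HeytAlg.{u} :=
  {A | ∀ e ∈ E, ∀ x : ℕ → A, e.1.eval x = e.2.eval x}

/-- A variety of Heyting algebras is an equational class. -/
def IsHeytingVariety (V : Set HeytAlg.{u}) : Prop :=
  ∃ E : Set (HeytingTerm × HeytingTerm), V = equationalClass E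

/-- A class `V` omits `P` if no member of `V` is isomorphic to `P`. (An order isomorphism of
Heyting algebras is the same as an isomorphism of Heyting algebras.) -/
def Omits (V : Set HeytAlg.{u}) (P : HeytAlg.{v}) : Prop :=
  ∀ A ∈ V, ¬ Nonempty (A ≃o P)

/-! ### Projectivity -/

/-- `A` is projective in the class `V`. -/
def IsProjectiveIn (V : Set HeytAlg.{u}) (A : HeytAlg.{u}) : Prop :=
  A ∈ V ∧ ∀ A₁ ∈ V, ∀ A₂ ∈ V, ∀ h : HeytingHom A₁ A₂, Function.Surjective h →
    ∀ f : HeytingHom A A₂, ∃ g : HeytingHom A A₁, h.comp g = f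

/-- `A` is weakly projective in the class `K`: whenever `A` is a homomorphic image of some
`B ∈ K`, it is isomorphic to a subalgebra of `B`. -/
def IsWeaklyProjectiveIn (K : Set HeytAlg.{u}) (A : HeytAlg.{u}) : Prop :=
  A ∈ K ∧ ∀ B ∈ K, (∃ h : HeytingHom B A, Function.Surjective h) →
    ∃ g : HeytingHom A B, Function.Injective g

/-! ### Subdirectly irreducible and nodeless algebras -/

/-- Congruences of a Heyting algebra. -/
def IsHeytingCongruence {A : Type u} [HeytingAlgebra A] (θ : Setoid A) : Prop :=
  ∀ a a' b b' : A, θ a a' → θ b b' →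
    θ (a ⊓ b) (a' ⊓ b') ∧ θ (a ⊔ b) (a' ⊔ b') ∧ θ (a ⇨ b) (a' ⇨ b')

/-- A nontrivial algebra is subdirectly irreducible if the meet of all congruences distinct from
the identity is distinct from the identity. -/
def IsSubdirectlyIrreducible (A : Type u) [HeytingAlgebra A] : Prop :=
  Nontrivial A ∧ sInf {θ : Setoid A | IsHeytingCongruence θ ∧ θ ≠ ⊥} ≠ ⊥

/-- A node is an element that is comparable with every element. -/
def IsNode {A : Type u} [HeytingAlgebra A] (a : A) : Prop :=
  ∀ b : A, a ≤ b ∨ b ≤ a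

/-- A nontrivial algebra is nodeless if `0` and `1` are its only nodes. -/
def IsNodeless (A : Type u) [HeytingAlgebra A] : Prop :=
  Nontrivial A ∧ ∀ a : A, IsNode a → a = ⊥ ∨ a = ⊤

/-! ### Coalesced ordinal sums -/

/-- The coalesced ordinal sum of `A` and `B`: the elements `(a, 0)` form a copy of `A`, the elements
`(1, b)` form a copy of `B` above it, and the only common element is `(1, 0)`. The order is the
componentwise one. -/
def OrdSum (A : Type u) (B : Type v) [HeytingAlgebra A] [HeytingAlgebra B] : Type (max u v) :=
  {x : A × B // x.1 = ⊤ ∨ x.2 = ⊥}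

namespace OrdSum

variable {A : Type u} {B : Type v} [HeytingAlgebra A] [HeytingAlgebra B]

instance : PartialOrder (OrdSum A B) :=
  inferInstanceAs (PartialOrder {x : A × B // x.1 = ⊤ ∨ x.2 = ⊥})

open Classical in
noncomputable instance : HeytingAlgebra (OrdSum A B) where
  sup x y := ⟨x.1 ⊔ y.1, by
    rcases x.2 with hx | hx <;> rcases y.2 with hy | hy <;> simp [hx, hy]⟩
  inf x y := ⟨x.1 ⊓ y.1, by
    rcases x.2 with hx | hx <;> rcases y.2 with hy | hy <;> simp [hx, hy]⟩
  top := ⟨⊤, Or.inl rfl⟩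
  bot := ⟨⊥, Or.inr rfl⟩
  himp x y := ⟨(x.1.1 ⇨ y.1.1, if x.1.1 ⇨ y.1.1 = ⊤ then x.1.2 ⇨ y.1.2 else ⊥), by
    by_cases h : x.1.1 ⇨ y.1.1 = ⊤
    · exact Or.inl h
    · exact Or.inr (if_neg h)⟩
  compl x := ⟨(x.1.1ᶜ, if x.1.1ᶜ = ⊤ then x.1.2ᶜ else ⊥), by
    by_cases h : x.1.1ᶜ = ⊤
    · exact Or.inl h
    · exact Or.inr (if_neg h)⟩
  le_sup_left x y := (le_sup_left : x.1 ≤ x.1 ⊔ y.1)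
  le_sup_right x y := (le_sup_right : y.1 ≤ x.1 ⊔ y.1)
  sup_le x y z hx hy := (sup_le hx hy : x.1 ⊔ y.1 ≤ z.1)
  inf_le_left x y := (inf_le_left : x.1 ⊓ y.1 ≤ x.1)
  inf_le_right x y := (inf_le_right : x.1 ⊓ y.1 ≤ y.1)
  le_inf x y z hx hy := (le_inf hx hy : x.1 ≤ y.1 ⊓ z.1)
  le_top x := (le_top : x.1 ≤ ⊤)
  bot_le x := (bot_le : ⊥ ≤ x.1)
  le_himp_iff x y z := by
    obtain ⟨⟨x₁, x₂⟩, hx⟩ := x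
    obtain ⟨⟨y₁, y₂⟩, hy⟩ := y
    obtain ⟨⟨z₁, z₂⟩, hz⟩ := z
    change (x₁ ≤ y₁ ⇨ z₁ ∧ x₂ ≤ if y₁ ⇨ z₁ = ⊤ then y₂ ⇨ z₂ else ⊥) ↔
      (x₁ ⊓ y₁ ≤ z₁ ∧ x₂ ⊓ y₂ ≤ z₂)
    rw [← le_himp_iff, ← le_himp_iff]
    refine and_congr_right fun h₁ => ?_
    split_ifs with h
    · exact Iff.rfl
    · have hx₁ : x₁ ≠ ⊤ := fun e => h (top_le_iff.1 (e ▸ h₁))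
      have hx₂ : x₂ = ⊥ := hx.resolve_left hx₁
      simp [hx₂]
  himp_bot x := by
    apply Subtype.ext
    change (x.1.1 ⇨ (⊥ : A), if x.1.1 ⇨ (⊥ : A) = ⊤ then x.1.2 ⇨ (⊥ : B) else ⊥) =
      (x.1.1ᶜ, if x.1.1ᶜ = ⊤ then x.1.2ᶜ else ⊥)
    simp

end OrdSum

/-- The coalesced ordinal sum `A + B`, as an operation on Heyting algebras. -/
noncomputable def ordSum (A : HeytAlg.{u}) (B : HeytAlg.{v}) : HeytAlg.{max u v} :=
  HeytAlg.of (OrdSum A B)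

/-! ### Some finite algebras -/

/-- The trivial algebra. -/
noncomputable def algZ1 : HeytAlg.{0} := HeytAlg.of PUnit.{1}

/-- The two-element Boolean algebra `2`. -/
noncomputable def algZ2 : HeytAlg.{0} := HeytAlg.of Bool

/-- The four-element Boolean algebra. -/
noncomputable def algZ4 : HeytAlg.{0} := HeytAlg.of (Bool × Bool)

/-- The six-element cyclic algebra, the product of the chains with two and with three elements. -/
noncomputable def algZ6 : HeytAlg.{0} := HeytAlg.of (Bool × Fin 3)

/-- The four-element poset with minimal elements `p`, `q` and maximal elements `r`, `s` in which
`r` covers `q` and `s` covers `p` and `q`. -/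
inductive PosetZ8 : Type
  | p | q | r | s

instance : PartialOrder PosetZ8 where
  le x y := x = y ∨ (x = .q ∧ y = .r) ∨ (x = .p ∧ y = .s) ∨ (x = .q ∧ y = .s)
  le_refl x := Or.inl rfl
  le_trans x y z := by cases x <;> cases y <;> cases z <;> simp
  le_antisymm x y := by cases x <;> cases y <;> simp

/-- The eight-element cyclic algebra, given by its poset of join-irreducible elements. -/
noncomputable def algZ8 : HeytAlg.{0} := HeytAlg.of (LowerSet PosetZ8)

/-- The five-element poset with minimal elements `l`, `c`, `r` and maximal elements `x`, `y` in
which `x` covers `l` and `c`, and `y` covers `c` and `r`. -/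
inductive PosetD : Type
  | l | c | r | x | y

instance : PartialOrder PosetD where
  le a b := a = b ∨ (a = .l ∧ b = .x) ∨ (a = .c ∧ b = .x) ∨ (a = .c ∧ b = .y) ∨ (a = .r ∧ b = .y)
  le_refl a := Or.inl rfl
  le_trans a b d := by cases a <;> cases b <;> cases d <;> simp
  le_antisymm a b := by cases a <;> cases b <;> simp

/-- A thirteen-element algebra, given by its poset of join-irreducible elements. -/
noncomputable def algD : HeytAlg.{0} := HeytAlg.of (LowerSet PosetD)

/-- The five prohibited algebras `P₁ = Z₆ + 2`, `P₂ = 2 + Z₆ + 2`, `P₃ = 2³ + 2`,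
`P₄ = 2 + 2³ + 2`, `P₅ = D + 2`. -/
noncomputable def prohibited : Fin 5 → HeytAlg.{0} :=
  ![ordSum algZ6 algZ2,
    ordSum algZ2 (ordSum algZ6 algZ2),
    ordSum (HeytAlg.of (Bool × Bool × Bool)) algZ2,
    ordSum algZ2 (ordSum (HeytAlg.of (Bool × Bool × Bool)) algZ2),
    ordSum algD algZ2]

/-- The largest variety `W` of Heyting algebras omitting all prohibited algebras: an algebra belongs
to it if and only if it belongs to some variety omitting all prohibited algebras. -/
def varietyW : Set HeytAlg.{u} :=
  {A | ∃ V : Set HeytAlg.{u}, IsHeytingVariety V ∧ (∀ i, Omits V (prohibited i)) ∧ A ∈ V}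

/-- The class `varietyW` omits all prohibited algebras. -/
theorem varietyW_omits (i : Fin 5) : Omits varietyW.{u} (prohibited i) := by
  rintro A ⟨V, -, hV, hA⟩
  exact hV i A hA

/-- If `L` is the largest variety that omits all prohibited algebras, then `L` is `varietyW`. -/
theorem eq_varietyW_of_isGreatest {L : Set HeytAlg.{u}}
    (hL : IsGreatest {V | IsHeytingVariety V ∧ ∀ i, Omits V (prohibited i)} L) :
    L = varietyW := by
  apply Set.Subset.antisymm
  · exact fun A hA => ⟨L, hL.1.1, hL.1.2, hA⟩
  · rintro A ⟨V, hV, hV', hA⟩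
    exact hL.2 ⟨hV, hV'⟩ hA

/-- The sum `B₀ + B₁ + ⋯ + Bₘ + 2`, where `Bs` is the list `B₁, …, Bₘ`. -/
noncomputable def sumAddTwo (B₀ : HeytAlg.{u}) (Bs : List HeytAlg.{u}) : HeytAlg.{u} :=
  ordSum (Bs.foldl ordSum B₀) algZ2

/-! ### Algebras separated from the prohibited ones by equations -/

/-! Structure. A finite subdirectly irreducible algebra has a greatest element below `⊤`, so it is
`L + 2`, and cutting `L` at its nodes writes it as a sum of nodeless algebras. A finite nodeless
algebra consists of the lower sets of a finite poset that is not an ordinal sum. Surjective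
p-morphisms of posets yield subalgebras and injective ones yield quotients, so in a poset that is
too complicated some prohibited algebra appears as a subalgebra of a quotient. A summand with
something nontrivial below it contributes `2 + B + 2`, and P₂ and P₄ leave only `Z₂` and `Z₄`
(`OmitsProhibited.classify_two_add`). The lowest summand contributes only `B₀ + 2`. Identifying all
minimal points brings P₂ and P₄ to bear on the upper part of its poset, while P₁, P₃ and P₅ control
how the minimal points are attached; a point, two incomparable points and the poset of `Z₈` remain
(`OmitsProhibited.classify_add_two`).

Projectivity. A homomorphism from `L + 2` amounts to a map on `L` that respects everything except
implications with value `⊤` (`IsPartialHeytingHom`). For `L` the lower sets of a finite poset,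
lifting such a map means choosing preimages of the join-irreducibles subject to finitely many
inequalities (`isPartialHeytingHom_joinOf`). For `Z₂` and `Z₄` any preimage `a` can be corrected in
any Heyting algebra, by `a ⊔ aᶜ` and by the pair `aᶜᶜ`, `aᶜ`. For `Z₈`, generated by one element,
the only inequality that is not automatic is Scott's, which follows from the omission of P₁
(`OmitsProhibited.scott`). Sums are lifted from the bottom upwards: the next summand is lifted into
the interval above the image of the last node (`HasLift.ordSum`). Nothing is known about that
interval, but the upper summands are `Z₂` or `Z₄` and lift into every algebra. Weak projectivity is
the lifting of the identity.

Throughout, membership in the variety is replaced by `OmitsProhibited`, which passes to subalgebras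
and quotients and does not depend on the universe. -/

theorem HeytingTerm.map_eval {A B : Type*} [HeytingAlgebra A] [HeytingAlgebra B]
    (f : HeytingHom A B) (x : ℕ → A) (t : HeytingTerm) :
    f (t.eval x) = t.eval (fun n => f (x n)) := by
  induction t with
  | var n => rfl
  | bot => exact map_bot f
  | top => exact map_top f
  | inf s t hs ht => simp only [eval, map_inf, hs, ht]
  | sup s t hs ht => simp only [eval, map_sup, hs, ht]
  | imp s t hs ht => simp only [eval, map_himp, hs, ht]

/-- The algebra `A` satisfies all equations in `E`. -/
def Satisfies (A : Type*) [HeytingAlgebra A] (E : Set (HeytingTerm × HeytingTerm)) : Prop :=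
  ∀ e ∈ E, ∀ x : ℕ → A, e.1.eval x = e.2.eval x

section Satisfies

variable {A B : Type*} [HeytingAlgebra A] [HeytingAlgebra B] {E : Set (HeytingTerm × HeytingTerm)}

theorem Satisfies.of_injective (h : Satisfies A E) (f : HeytingHom B A)
    (hf : Function.Injective f) : Satisfies B E := by
  intro e he x
  apply hf
  rw [HeytingTerm.map_eval, HeytingTerm.map_eval]
  exact h e he _

theorem Satisfies.of_surjective (h : Satisfies A E) (f : HeytingHom A B)
    (hf : Function.Surjective f) : Satisfies B E := by
  intro e he x
  choose y hy using fun n => hf (x n)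
  obtain rfl : (fun n => f (y n)) = x := funext hy
  rw [← HeytingTerm.map_eval, ← HeytingTerm.map_eval, h e he y]

/-- Some equational class contains `A` and none of the prohibited algebras. -/
def OmitsProhibited (A : Type*) [HeytingAlgebra A] : Prop :=
  ∃ E, Satisfies A E ∧ ∀ i, ¬ Satisfies (prohibited i) E

theorem OmitsProhibited.of_injective (h : OmitsProhibited A) (f : HeytingHom B A)
    (hf : Function.Injective f) : OmitsProhibited B :=
  let ⟨E, hE, hP⟩ := h
  ⟨E, hE.of_injective f hf, hP⟩

theorem OmitsProhibited.of_surjective (h : OmitsProhibited A) (f : HeytingHom A B)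
    (hf : Function.Surjective f) : OmitsProhibited B :=
  let ⟨E, hE, hP⟩ := h
  ⟨E, hE.of_surjective f hf, hP⟩

theorem OmitsProhibited.of_orderIso (h : OmitsProhibited A) (f : B ≃o A) : OmitsProhibited B :=
  h.of_injective (f : HeytingHom B A) f.injective

theorem not_omitsProhibited_of_orderIso (i : Fin 5) (f : A ≃o prohibited i) :
    ¬ OmitsProhibited A :=
  fun ⟨_, hE, hP⟩ => hP i (hE.of_injective (f.symm : HeytingHom (prohibited i) A) f.symm.injective)

end Satisfies

instance ULift.instHeytingAlgebra {A : Type v} [HeytingAlgebra A] :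
    HeytingAlgebra (ULift.{u} A) where
  himp x y := ⟨x.down ⇨ y.down⟩
  compl x := ⟨x.downᶜ⟩
  le_himp_iff x y z := le_himp_iff (a := x.down) (b := y.down) (c := z.down)
  himp_bot x := congrArg ULift.up (himp_bot x.down)
  le_top x := le_top (a := x.down)
  bot_le x := bot_le (a := x.down)

/-- The prohibited algebras live in universe 0. If one of them satisfied the defining equations, its
lift to universe `u` would be a member of the variety isomorphic to it. -/
theorem omitsProhibited_of_mem_varietyW {A : HeytAlg.{u}} (hA : A ∈ varietyW.{u}) :
    OmitsProhibited A := by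
  obtain ⟨V, ⟨E, rfl⟩, hV, hA⟩ := hA
  refine ⟨E, hA, fun i hi => ?_⟩
  let e : ULift.{u} (prohibited i) ≃o prohibited i := ⟨Equiv.ulift, Iff.rfl⟩
  exact hV i (HeytAlg.of (ULift.{u} (prohibited i)))
    (hi.of_injective (e : HeytingHom (ULift.{u} (prohibited i)) (prohibited i)) e.injective) ⟨e⟩

/-! ### Homomorphisms on coalesced ordinal sums -/

namespace OrdSum

variable {A B : Type*} [HeytingAlgebra A] [HeytingAlgebra B]

theorem le_def {x y : OrdSum A B} : x ≤ y ↔ x.1.1 ≤ y.1.1 ∧ x.1.2 ≤ y.1.2 := Iff.rfl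

/-- The copy of `A` in `A + B`. -/
def inl (a : A) : OrdSum A B := ⟨(a, ⊥), Or.inr rfl⟩

/-- The copy of `B` in `A + B`. -/
def inr (b : B) : OrdSum A B := ⟨(⊤, b), Or.inl rfl⟩

theorem inl_top : (inl ⊤ : OrdSum A B) = inr ⊥ := rfl

theorem inl_bot : (inl ⊥ : OrdSum A B) = ⊥ := rfl

theorem inr_top : (inr ⊤ : OrdSum A B) = ⊤ := rfl

theorem inl_injective : Function.Injective (inl : A → OrdSum A B) :=
  fun _ _ h => congrArg (fun x : OrdSum A B => x.1.1) h

theorem inr_injective : Function.Injective (inr : B → OrdSum A B) :=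
  fun _ _ h => congrArg (fun x : OrdSum A B => x.1.2) h

@[elab_as_elim]
theorem cases_sum {p : OrdSum A B → Prop} (hl : ∀ a, a ≠ ⊤ → p (inl a)) (hr : ∀ b, p (inr b))
    (x : OrdSum A B) : p x := by
  obtain ⟨⟨a, b⟩, h⟩ := x
  by_cases ha : a = ⊤
  · subst ha
    exact hr b
  · obtain rfl : b = ⊥ := h.resolve_left ha
    exact hl a ha

theorem inl_le_inl {a a' : A} : (inl a : OrdSum A B) ≤ inl a' ↔ a ≤ a' :=
  ⟨And.left, fun h => ⟨h, le_rfl⟩⟩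

theorem inr_le_inr {b b' : B} : (inr b : OrdSum A B) ≤ inr b' ↔ b ≤ b' :=
  ⟨And.right, fun h => ⟨le_rfl, h⟩⟩

theorem inl_le_inr {a : A} {b : B} : (inl a : OrdSum A B) ≤ inr b :=
  ⟨le_top, bot_le⟩

theorem inr_le_inl {a : A} {b : B} : (inr b : OrdSum A B) ≤ inl a ↔ a = ⊤ ∧ b = ⊥ :=
  and_congr top_le_iff le_bot_iff

theorem inl_inf (a a' : A) : (inl (a ⊓ a') : OrdSum A B) = inl a ⊓ inl a' :=
  Subtype.ext (Prod.ext rfl (inf_idem _).symm)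

theorem inl_sup (a a' : A) : (inl (a ⊔ a') : OrdSum A B) = inl a ⊔ inl a' :=
  Subtype.ext (Prod.ext rfl (sup_idem _).symm)

theorem inr_inf (b b' : B) : (inr (b ⊓ b') : OrdSum A B) = inr b ⊓ inr b' :=
  Subtype.ext (Prod.ext (inf_idem _).symm rfl)

theorem inr_sup (b b' : B) : (inr (b ⊔ b') : OrdSum A B) = inr b ⊔ inr b' :=
  Subtype.ext (Prod.ext (sup_idem _).symm rfl)

theorem inr_himp (b b' : B) : (inr (b ⇨ b') : OrdSum A B) = inr b ⇨ inr b' := by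
  refine eq_of_forall_le_iff fun x => ?_
  induction x using cases_sum with
  | hl a ha => simp [inl_le_inr, le_himp_iff]
  | hr c => simp [inr_le_inr, le_himp_iff, ← inr_inf]

/-- For `a ≤ a'` the right side is the top of the whole sum while the left side is only the gluing
point. This failure is what `IsPartialHeytingHom` is designed to tolerate. -/
theorem inl_himp {a a' : A} (h : ¬ a ≤ a') : (inl (a ⇨ a') : OrdSum A B) = inl a ⇨ inl a' := by
  refine eq_of_forall_le_iff fun x => ?_
  induction x using cases_sum with
  | hl c hc => simp [inl_le_inl, le_himp_iff, ← inl_inf]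
  | hr c =>
    simp [inr_le_inl, le_himp_iff, inf_of_le_right (inl_le_inr : (inl a : OrdSum A B) ≤ inr c),
      inl_le_inl, h]

theorem inr_himp_inl {a : A} (b : B) (ha : a ≠ ⊤) : (inr b ⇨ inl a : OrdSum A B) = inl a := by
  refine le_antisymm ?_ (le_himp_iff.2 inf_le_left)
  have key : ∀ x : OrdSum A B, x ≤ inr b ⇨ inl a → x ≤ inl a := by
    intro x hx
    rw [le_himp_iff] at hx
    induction x using cases_sum with
    | hl c hc => rwa [inf_of_le_left inl_le_inr] at hx
    | hr c =>
      rw [← inr_inf, inr_le_inl] at hx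
      exact absurd hx.1 ha
  exact key _ le_rfl

end OrdSum

/-- A map between Heyting algebras that preserves all operations, except that an implication
`x ⇨ y` with `x ≤ y` need not go to the top element. -/
structure IsPartialHeytingHom {A B : Type*} [HeytingAlgebra A] [HeytingAlgebra B] (f : A → B) :
    Prop where
  map_bot : f ⊥ = ⊥
  map_inf : ∀ a b, f (a ⊓ b) = f a ⊓ f b
  map_sup : ∀ a b, f (a ⊔ b) = f a ⊔ f b
  map_himp : ∀ a b, ¬ a ≤ b → f (a ⇨ b) = f a ⇨ f b

/-- A map between Heyting algebras that preserves all operations except possibly the bottom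
element. -/
structure IsBrouwerianHom {A B : Type*} [HeytingAlgebra A] [HeytingAlgebra B] (f : A → B) :
    Prop where
  map_inf : ∀ a b, f (a ⊓ b) = f a ⊓ f b
  map_sup : ∀ a b, f (a ⊔ b) = f a ⊔ f b
  map_himp : ∀ a b, f (a ⇨ b) = f a ⇨ f b

section Homs

variable {A B C : Type*} [HeytingAlgebra A] [HeytingAlgebra B] [HeytingAlgebra C]

theorem IsPartialHeytingHom.mono {f : A → B} (h : IsPartialHeytingHom f) : Monotone f :=
  fun a b hab => by rw [← inf_eq_left, ← h.map_inf, inf_of_le_left hab]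

theorem IsBrouwerianHom.mono {f : A → B} (h : IsBrouwerianHom f) : Monotone f :=
  fun a b hab => by rw [← inf_eq_left, ← h.map_inf, inf_of_le_left hab]

theorem IsBrouwerianHom.map_top {f : A → B} (h : IsBrouwerianHom f) : f ⊤ = ⊤ := by
  rw [← himp_self (a := (⊥ : A)), h.map_himp, himp_self]

theorem HeytingHom.isBrouwerianHom (f : HeytingHom A B) : IsBrouwerianHom f :=
  ⟨map_inf f, map_sup f, map_himp f⟩

theorem OrdSum.isPartialHeytingHom_inl : IsPartialHeytingHom (OrdSum.inl : A → OrdSum A B) :=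
  ⟨rfl, inl_inf, inl_sup, fun _ _ => inl_himp⟩

theorem OrdSum.isBrouwerianHom_inr : IsBrouwerianHom (OrdSum.inr : B → OrdSum A B) :=
  ⟨inr_inf, inr_sup, inr_himp⟩

theorem IsPartialHeytingHom.comp {g : B → C} {f : A → B} (hg : IsPartialHeytingHom g)
    (hf : IsPartialHeytingHom f) (hinj : Function.Injective f) : IsPartialHeytingHom (g ∘ f) where
  map_bot := by simp [hf.map_bot, hg.map_bot]
  map_inf a b := by simp [hf.map_inf, hg.map_inf]
  map_sup a b := by simp [hf.map_sup, hg.map_sup]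
  map_himp a b h := by
    have : ¬ f a ≤ f b := fun h' => h <| by
      rw [← inf_eq_left, ← hf.map_inf] at h'
      exact inf_eq_left.1 (hinj h')
    simp [hf.map_himp a b h, hg.map_himp _ _ this]

theorem HeytingHom.comp_isPartialHeytingHom (g : HeytingHom B C) {f : A → B}
    (hf : IsPartialHeytingHom f) : IsPartialHeytingHom (g ∘ f) where
  map_bot := by simp [hf.map_bot]
  map_inf a b := by simp [hf.map_inf]
  map_sup a b := by simp [hf.map_sup]
  map_himp a b h := by simp [hf.map_himp a b h]

theorem IsBrouwerianHom.comp {g : B → C} {f : A → B} (hg : IsBrouwerianHom g)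
    (hf : IsBrouwerianHom f) : IsBrouwerianHom (g ∘ f) where
  map_inf a b := by simp [hf.map_inf, hg.map_inf]
  map_sup a b := by simp [hf.map_sup, hg.map_sup]
  map_himp a b := by simp [hf.map_himp, hg.map_himp]

namespace OrdSum

open Classical in
/-- The map on `A + B` given by a map on `A` and a map on `B`. -/
noncomputable def elim {C : Type*} (f : A → C) (g : B → C) (x : OrdSum A B) : C :=
  if x.1.1 = ⊤ then g x.1.2 else f x.1.1

variable {f : A → C} {g : B → C}

theorem elim_inr {C : Type*} {f : A → C} {g : B → C} (b : B) : elim f g (inr b) = g b := if_pos rfl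

theorem elim_inl (h : f ⊤ = g ⊥) (a : A) : elim f g (inl a) = f a := by
  by_cases ha : a = ⊤
  · subst ha
    rw [inl_top, elim_inr, h]
  · exact if_neg ha

/-- Gluing a homomorphism on `A + B` together. -/
noncomputable def lift (hf : IsPartialHeytingHom f) (hg : IsBrouwerianHom g) (h : f ⊤ = g ⊥) :
    HeytingHom (OrdSum A B) C :=
  have hle : ∀ a b, f a ≤ g b := fun a b =>
    ((hf.mono le_top).trans h.le).trans (hg.mono bot_le)
  have hinf : ∀ x y, elim f g (x ⊓ y) = elim f g x ⊓ elim f g y := by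
    intro x y
    induction x using cases_sum with
    | hl a ha =>
      induction y using cases_sum with
      | hl b hb => rw [← inl_inf, elim_inl h, elim_inl h, elim_inl h, hf.map_inf]
      | hr b => rw [inf_of_le_left inl_le_inr, elim_inl h, elim_inr, inf_of_le_left (hle a b)]
    | hr a =>
      induction y using cases_sum with
      | hl b hb => rw [inf_of_le_right inl_le_inr, elim_inl h, elim_inr, inf_of_le_right (hle b a)]
      | hr b => rw [← inr_inf, elim_inr, elim_inr, elim_inr, hg.map_inf]
  { toFun := elim f g
    map_inf' := hinf
    map_sup' := by
      intro x y
      induction x using cases_sum with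
      | hl a ha =>
        induction y using cases_sum with
        | hl b hb => rw [← inl_sup, elim_inl h, elim_inl h, elim_inl h, hf.map_sup]
        | hr b => rw [sup_of_le_right inl_le_inr, elim_inl h, elim_inr, sup_of_le_right (hle a b)]
      | hr a =>
        induction y using cases_sum with
        | hl b hb => rw [sup_of_le_left inl_le_inr, elim_inl h, elim_inr, sup_of_le_left (hle b a)]
        | hr b => rw [← inr_sup, elim_inr, elim_inr, elim_inr, hg.map_sup]
    map_bot' := by
      rw [← inl_bot, elim_inl h, hf.map_bot]
    map_himp' := by
      intro x y
      have htop : elim f g (⊤ : OrdSum A B) = ⊤ := by rw [← inr_top, elim_inr, hg.map_top]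
      by_cases hxy : x ≤ y
      · have : elim f g x ≤ elim f g y := by
          rw [← inf_eq_left, ← hinf, inf_of_le_left hxy]
        rw [himp_eq_top_iff.2 hxy, himp_eq_top_iff.2 this, htop]
      induction x using cases_sum with
      | hl a ha =>
        induction y using cases_sum with
        | hl b hb =>
          have hab : ¬ a ≤ b := fun hab => hxy (inl_le_inl.2 hab)
          rw [← inl_himp hab, elim_inl h, elim_inl h, elim_inl h, hf.map_himp a b hab]
        | hr b => exact absurd inl_le_inr hxy
      | hr a =>
        induction y using cases_sum with
        | hl b hb =>
          rw [inr_himp_inl a hb, elim_inl h, elim_inr]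
          refine le_antisymm (le_himp_iff.2 inf_le_left) ?_
          -- As `b ≠ ⊤`, the implication `⊤ ⇨ b = b` is one that `f` preserves, and `g a` lies above
          -- `f ⊤ = g ⊥`.
          have h1 : f ⊤ ⇨ f b = f b := by
            rw [← hf.map_himp ⊤ b fun h' => hb (top_le_iff.1 h'), top_himp]
          exact (himp_le_himp_right (h.le.trans (hg.mono bot_le))).trans h1.le
        | hr b => rw [← inr_himp, elim_inr, elim_inr, elim_inr, hg.map_himp] }

variable (hf : IsPartialHeytingHom f) (hg : IsBrouwerianHom g) (h : f ⊤ = g ⊥)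

theorem lift_inl (a : A) : lift hf hg h (inl a) = f a := elim_inl h a

theorem lift_inr (b : B) : lift hf hg h (inr b) = g b := elim_inr b

theorem lift_injective (hfi : Function.Injective f) (hgi : Function.Injective g) :
    Function.Injective (lift hf hg h) := by
  have key : ∀ a b, a ≠ ⊤ → f a ≠ g b := by
    intro a b ha hab
    refine ha (hfi (le_antisymm (hf.mono le_top) ?_))
    rw [hab, h]
    exact hg.mono bot_le
  intro x y hxy
  induction x using cases_sum with
  | hl a ha =>
    induction y using cases_sum with
    | hl b hb => rw [lift_inl, lift_inl] at hxy; rw [hfi hxy]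
    | hr b => rw [lift_inl, lift_inr] at hxy; exact absurd hxy (key a b ha)
  | hr a =>
    induction y using cases_sum with
    | hl b hb => rw [lift_inl, lift_inr] at hxy; exact absurd hxy.symm (key b a hb)
    | hr b => rw [lift_inr, lift_inr] at hxy; rw [hgi hxy]

theorem hom_ext {f g : HeytingHom (OrdSum A B) C} (hl : ∀ a, f (inl a) = g (inl a))
    (hr : ∀ b, f (inr b) = g (inr b)) : f = g := by
  refine DFunLike.ext _ _ fun x => ?_
  induction x using cases_sum with
  | hl a _ => exact hl a
  | hr b => exact hr b

end OrdSum

/-- The map on the two-element algebra that sends the top element to the top element. -/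
theorem isBrouwerianHom_bool (c : C) : IsBrouwerianHom (fun b : Bool => if b then ⊤ else c) where
  map_inf a b := by cases a <;> cases b <;> simp
  map_sup a b := by cases a <;> cases b <;> simp
  map_himp a b := by cases a <;> cases b <;> simp

/-- The map on the two-element algebra that sends the top element to a dense element. -/
theorem isPartialHeytingHom_bool {c : C} (hc : cᶜ = ⊥) :
    IsPartialHeytingHom (fun b : Bool => if b then c else ⊥) where
  map_bot := rfl
  map_inf a b := by cases a <;> cases b <;> simp
  map_sup a b := by cases a <;> cases b <;> simp
  map_himp a b h := by cases a <;> cases b <;> simp_all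

/-- The homomorphism from `A + 2` given by a partial homomorphism on `A`. -/
noncomputable def IsPartialHeytingHom.addTwo {f : A → C} (hf : IsPartialHeytingHom f) :
    HeytingHom (OrdSum A Bool) C :=
  OrdSum.lift hf (isBrouwerianHom_bool (f ⊤)) rfl

theorem IsPartialHeytingHom.addTwo_inl {f : A → C} (hf : IsPartialHeytingHom f) (a : A) :
    hf.addTwo (OrdSum.inl a) = f a := OrdSum.lift_inl _ _ _ a

theorem IsPartialHeytingHom.addTwo_injective {f : A → C} (hf : IsPartialHeytingHom f)
    (hi : Function.Injective f) (ht : f ⊤ ≠ ⊤) : Function.Injective hf.addTwo := by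
  refine OrdSum.lift_injective _ _ _ hi fun a b hab => ?_
  cases a <;> cases b
  · rfl
  · exact absurd hab ht
  · exact absurd hab.symm ht
  · rfl

/-- This is how a prohibited sum is embedded: the new top goes to `⊤`, and `f ⊤ ≠ ⊤` keeps the two
apart. -/
theorem OmitsProhibited.addTwo_of_partial (h : OmitsProhibited C) {f : A → C}
    (hf : IsPartialHeytingHom f) (hi : Function.Injective f) (ht : f ⊤ ≠ ⊤) :
    OmitsProhibited (OrdSum A Bool) :=
  h.of_injective hf.addTwo (hf.addTwo_injective hi ht)

/-- Since `f ⊥` is dense, adding `⊥` to the image of `f` gives a subalgebra. -/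
theorem OmitsProhibited.twoAdd_of_brouwerian (h : OmitsProhibited C) {f : A → C}
    (hf : IsBrouwerianHom f) (hi : Function.Injective f) (hb : f ⊥ ≠ ⊥) (hd : (f ⊥)ᶜ = ⊥) :
    OmitsProhibited (OrdSum Bool A) := by
  refine h.of_injective (OrdSum.lift (isPartialHeytingHom_bool hd) hf rfl)
    (OrdSum.lift_injective _ _ _ (fun a b hab => ?_) hi)
  cases a <;> cases b
  · rfl
  · exact absurd hab.symm hb
  · exact absurd hab hb
  · rfl

end Homs

namespace OrdSum

variable {A B C D : Type*} [HeytingAlgebra A] [HeytingAlgebra B] [HeytingAlgebra C]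
  [HeytingAlgebra D]

/-- Isomorphic summands give isomorphic sums. -/
def congr (e : A ≃o C) (e' : B ≃o D) : OrdSum A B ≃o OrdSum C D where
  toFun x := ⟨(e x.1.1, e' x.1.2), x.2.imp (fun h => by simp [h]) (fun h => by simp [h])⟩
  invFun x := ⟨(e.symm x.1.1, e'.symm x.1.2),
    x.2.imp (fun h => by simp [h]) (fun h => by simp [h])⟩
  left_inv x := Subtype.ext (by simp)
  right_inv x := Subtype.ext (by simp)
  map_rel_iff' := and_congr e.le_iff_le e'.le_iff_le

/-- Associativity of coalesced ordinal sums. -/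
def assoc : OrdSum (OrdSum A B) C ≃o OrdSum A (OrdSum B C) where
  toFun x := ⟨(x.1.1.1.1, ⟨(x.1.1.1.2, x.1.2), by
      rcases x.2 with h | h
      · exact Or.inl (congrArg (fun z : OrdSum A B => z.1.2) h)
      · exact Or.inr h⟩), by
      rcases x.2 with h | h
      · exact Or.inl (congrArg (fun z : OrdSum A B => z.1.1) h)
      · rcases x.1.1.2 with h' | h'
        · exact Or.inl h'
        · exact Or.inr (Subtype.ext (Prod.ext h' h))⟩
  invFun x := ⟨(⟨(x.1.1, x.1.2.1.1), by
      rcases x.2 with h | h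
      · exact Or.inl h
      · exact Or.inr (congrArg (fun z : OrdSum B C => z.1.1) h)⟩, x.1.2.1.2), by
      rcases x.2 with h | h
      · rcases x.1.2.2 with h' | h'
        · exact Or.inl (Subtype.ext (Prod.ext h h'))
        · exact Or.inr h'
      · exact Or.inr (congrArg (fun z : OrdSum B C => z.1.2) h)⟩
  left_inv x := rfl
  right_inv x := rfl
  map_rel_iff' := and_assoc.symm

end OrdSum

/-! ### Lower sets of posets -/

namespace LowerSet

variable {X Y : Type*} [PartialOrder X] [PartialOrder Y]

theorem mem_himp_iff {S T : LowerSet X} {x : X} : x ∈ S ⇨ T ↔ ∀ y ≤ x, y ∈ S → y ∈ T := by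
  rw [← LowerSet.Iic_le, le_himp_iff]
  exact ⟨fun h y hy hS => h ⟨hy, hS⟩, fun h y hy => h y hy.1 hy.2⟩

theorem mem_compl_iff_forall {S : LowerSet X} {x : X} : x ∈ Sᶜ ↔ ∀ y ≤ x, y ∉ S := by
  rw [← himp_bot, mem_himp_iff]
  rfl

theorem mem_compl_Ici_iff {x y : X} : y ∈ (UpperSet.Ici x).compl ↔ ¬ x ≤ y := Iff.rfl

end LowerSet

/-- A map between posets is a p-morphism if it maps principal lower sets onto principal
lower sets. -/
def IsPMorphism {X Y : Type*} [PartialOrder X] [PartialOrder Y] (f : X → Y) : Prop :=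
  ∀ x y, y ≤ f x ↔ ∃ x' ≤ x, f x' = y

namespace IsPMorphism

variable {X Y : Type*} [PartialOrder X] [PartialOrder Y] {f : X → Y}

theorem monotone (hf : IsPMorphism f) : Monotone f := fun a b hab => (hf b _).2 ⟨a, hab, rfl⟩

/-- Taking preimages under a p-morphism is a homomorphism. -/
noncomputable def comap (hf : IsPMorphism f) : HeytingHom (LowerSet Y) (LowerSet X) where
  toFun S := ⟨f ⁻¹' S, fun _ _ hab ha => S.lower (hf.monotone hab) ha⟩
  map_sup' _ _ := rfl
  map_inf' _ _ := rfl
  map_bot' := rfl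
  map_himp' S T := by
    ext x
    change f x ∈ S ⇨ T ↔ x ∈ (_ ⇨ _ : LowerSet X)
    rw [LowerSet.mem_himp_iff, LowerSet.mem_himp_iff]
    constructor
    · intro h y hy
      exact h _ (hf.monotone hy)
    · intro h y hy
      obtain ⟨x', hx', rfl⟩ := (hf x y).1 hy
      exact h x' hx'

theorem comap_injective (hf : IsPMorphism f) (hs : Function.Surjective f) :
    Function.Injective hf.comap := by
  intro S T h
  ext y
  obtain ⟨x, rfl⟩ := hs y
  exact iff_of_eq (congrArg (fun U : LowerSet X => x ∈ U) h)

theorem comap_surjective (hf : IsPMorphism f) (hi : Function.Injective f) :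
    Function.Surjective hf.comap := by
  intro S
  refine ⟨⟨f '' S, ?_⟩, ?_⟩
  · rintro _ b hab ⟨x, hx, rfl⟩
    obtain ⟨x', hx', rfl⟩ := (hf x b).1 hab
    exact ⟨x', S.lower hx' hx, rfl⟩
  · ext x
    exact hi.mem_set_image

/-- Duality: a surjective p-morphism embeds the algebra of its codomain, and an injective one makes
the algebra of its domain a quotient. -/
theorem omitsProhibited (hf : IsPMorphism f) (hs : Function.Surjective f)
    (h : OmitsProhibited (LowerSet X)) : OmitsProhibited (LowerSet Y) :=
  h.of_injective hf.comap (hf.comap_injective hs)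

theorem omitsProhibited_of_injective (hf : IsPMorphism f) (hi : Function.Injective f)
    (h : OmitsProhibited (LowerSet Y)) : OmitsProhibited (LowerSet X) :=
  h.of_surjective hf.comap (hf.comap_surjective hi)

end IsPMorphism

/-! ### Partial homomorphisms given on the join-irreducible elements -/

section joinOf

variable {Y A : Type*} [PartialOrder Y] [Finite Y] [HeytingAlgebra A]

/-- The join of all `e y` with `y` in a given lower set. -/
noncomputable def joinOf (e : Y → A) (S : LowerSet Y) : A :=
  (Set.toFinite (S : Set Y)).toFinset.sup e

variable {e : Y → A}

theorem joinOf_le_iff {S : LowerSet Y} {a : A} : joinOf e S ≤ a ↔ ∀ y ∈ S, e y ≤ a := by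
  simp [joinOf, Finset.sup_le_iff]

theorem le_joinOf {S : LowerSet Y} {y : Y} (hy : y ∈ S) : e y ≤ joinOf e S :=
  joinOf_le_iff.1 le_rfl y hy

theorem joinOf_Iio_le_bot {x : Y} (hx : ∀ y, ¬ y < x) : joinOf e (LowerSet.Iio x) ≤ ⊥ :=
  joinOf_le_iff.2 fun y hy => absurd (LowerSet.mem_Iio_iff.1 hy) (hx y)

theorem joinOf_mono {S T : LowerSet Y} (h : S ≤ T) : joinOf e S ≤ joinOf e T :=
  joinOf_le_iff.2 fun _ hy => le_joinOf (h hy)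

theorem inf_joinOf_le_iff {S : LowerSet Y} {a b : A} :
    b ⊓ joinOf e S ≤ a ↔ ∀ y ∈ S, b ⊓ e y ≤ a := by
  simp only [inf_comm b, ← le_himp_iff, joinOf_le_iff]

/-- By distributivity, meets need only be checked on pairs of incomparable generators. For
implications, `S ⇨ T` is the intersection of the sets `(UpperSet.Ici x).compl` with `x` in `S` but
not in `T`, and minimal such `x` suffice. Each of these sets is `Iic x ⇨ Iio x`, the only kind of
implication left to check. -/
theorem isPartialHeytingHom_joinOf
    (hinf : ∀ x y, ¬ x ≤ y → ¬ y ≤ x → e x ⊓ e y ≤ joinOf e (LowerSet.Iic x ⊓ LowerSet.Iic y))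
    (hhimp : ∀ x, e x ⇨ joinOf e (LowerSet.Iio x) ≤ joinOf e (UpperSet.Ici x).compl) :
    IsPartialHeytingHom (joinOf e) := by
  have hI : ∀ S T, joinOf e (S ⊓ T) = joinOf e S ⊓ joinOf e T := by
    intro S T
    refine le_antisymm (le_inf (joinOf_mono inf_le_left) (joinOf_mono inf_le_right)) ?_
    rw [inf_joinOf_le_iff]
    intro y hy
    rw [inf_comm, inf_joinOf_le_iff]
    intro x hx
    by_cases hxy : x ≤ y
    · exact inf_le_right.trans (le_joinOf (show x ∈ S ⊓ T from ⟨hx, T.lower hxy hy⟩))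
    by_cases hyx : y ≤ x
    · exact inf_le_left.trans (le_joinOf (show y ∈ S ⊓ T from ⟨S.lower hyx hx, hy⟩))
    rw [inf_comm]
    exact (hinf x y hxy hyx).trans (joinOf_mono (inf_le_inf (LowerSet.Iic_le.2 hx)
      (LowerSet.Iic_le.2 hy)))
  have hJoin : ∀ S T : LowerSet Y, joinOf e (S ⊔ T) = joinOf e S ⊔ joinOf e T := by
    intro S T
    refine le_antisymm (joinOf_le_iff.2 ?_)
      (sup_le (joinOf_mono le_sup_left) (joinOf_mono le_sup_right))
    rintro y (hy | hy)
    · exact le_sup_of_le_left (le_joinOf hy)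
    · exact le_sup_of_le_right (le_joinOf hy)
  have hMeet : ∀ w : A, ∀ F : Finset Y, F.Nonempty →
      (∀ x ∈ F, w ≤ joinOf e (UpperSet.Ici x).compl) →
      ∃ U : LowerSet Y, w ≤ joinOf e U ∧ ∀ x ∈ F, U ≤ (UpperSet.Ici x).compl := by
    intro w F hF
    induction hF using Finset.Nonempty.cons_induction with
    | singleton a => exact fun h => ⟨_, h a (by simp), by simp⟩
    | cons a F ha hF ih =>
      intro h
      obtain ⟨U, hU, hUF⟩ := ih fun x hx => h x (Finset.mem_cons_of_mem hx)
      refine ⟨(UpperSet.Ici a).compl ⊓ U, ?_, ?_⟩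
      · rw [hI]
        exact le_inf (h a (Finset.mem_cons_self a F)) hU
      · intro x hx
        rcases Finset.mem_cons.1 hx with rfl | hx
        · exact inf_le_left
        · exact inf_le_right.trans (hUF x hx)
  refine ⟨le_bot_iff.1 (joinOf_le_iff.2 fun y hy => absurd hy id), hI, hJoin, ?_⟩
  intro S T hST
  refine le_antisymm (le_himp_iff.2 ?_) ?_
  · rw [← hI]
    exact joinOf_mono (le_himp_iff.1 le_rfl)
  set w := joinOf e S ⇨ joinOf e T with hw
  let F : Finset Y := (Set.toFinite {x | Minimal (fun y => y ∈ S ∧ y ∉ T) x}).toFinset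
  have hF : ∀ x, x ∈ F ↔ Minimal (fun y => y ∈ S ∧ y ∉ T) x := by simp [F]
  have hFex : ∀ y, y ∈ S → y ∉ T → ∃ x ∈ F, x ≤ y := by
    intro y hS hT
    obtain ⟨x, hxy, hx⟩ := (Set.toFinite {y | y ∈ S ∧ y ∉ T}).exists_le_minimal
      (show y ∈ {y | y ∈ S ∧ y ∉ T} from ⟨hS, hT⟩)
    exact ⟨x, (hF x).2 hx, hxy⟩
  -- An empty intersection would require `w ≤ joinOf e ⊤`, which may fail because `joinOf e ⊤` need
  -- not be `⊤`. Here `¬ S ≤ T` is essential.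
  have hne : F.Nonempty := by
    obtain ⟨y, hyS, hyT⟩ := Set.not_subset.1 hST
    obtain ⟨x, hx, -⟩ := hFex y hyS hyT
    exact ⟨x, hx⟩
  obtain ⟨U, hU, hUF⟩ := hMeet w F hne <| by
    intro x hx
    have hx := (hF x).1 hx
    refine le_trans ?_ (hhimp x)
    rw [le_himp_iff]
    have h1 : w ⊓ e x ≤ joinOf e T := by
      refine le_trans (inf_le_inf_left _ (le_joinOf hx.prop.1)) ?_
      rw [hw]
      exact himp_inf_le
    have h2 : e x ≤ joinOf e (LowerSet.Iic x) := le_joinOf (le_refl x)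
    refine (le_inf h1 (inf_le_right.trans h2)).trans ?_
    rw [← hI]
    refine joinOf_mono ?_
    rintro z ⟨hzT, hzx⟩
    refine lt_of_le_of_ne hzx ?_
    rintro rfl
    exact hx.prop.2 hzT
  refine hU.trans (joinOf_mono ?_)
  intro y hy
  refine LowerSet.mem_himp_iff.2 ?_
  intro z hz hzS
  by_contra hzT
  obtain ⟨x, hx, hxz⟩ := hFex z hzS hzT
  exact hUF x hx hy (hxz.trans hz)

/-- A lower set that misses `y` is contained in `(UpperSet.Ici y).compl`, so this is the only
inequality to exclude for each `y`. -/
theorem joinOf_le_joinOf_iff (hinj : ∀ y, ¬ e y ≤ joinOf e (UpperSet.Ici y).compl)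
    {S T : LowerSet Y} : joinOf e S ≤ joinOf e T ↔ S ≤ T := by
  refine ⟨fun h y hy => ?_, joinOf_mono⟩
  by_contra hyT
  exact hinj y ((le_joinOf hy).trans (h.trans (joinOf_mono fun z hz hyz => hyT (T.lower hyz hz))))

theorem map_joinOf {B : Type*} [HeytingAlgebra B] (f : HeytingHom A B) (S : LowerSet Y) :
    f (joinOf e S) = joinOf (f ∘ e) S :=
  map_finset_sup f _ _

theorem joinOf_Iic (S : LowerSet Y) : joinOf (LowerSet.Iic : Y → LowerSet Y) S = S :=
  le_antisymm (joinOf_le_iff.2 fun _ hy => LowerSet.Iic_le.2 hy)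
    fun y hy => le_joinOf (e := (LowerSet.Iic : Y → LowerSet Y)) hy (le_refl y)

end joinOf

/-! ### Some algebras of lower sets -/

/-- A surjective map that reflects and preserves the order is an isomorphism. -/
noncomputable def orderIsoOfSurjective {X Y : Type*} [PartialOrder X] [PartialOrder Y] (f : X → Y)
    (h : ∀ a b, f a ≤ f b ↔ a ≤ b) (hs : Function.Surjective f) : X ≃o Y :=
  RelIso.ofSurjective (OrderEmbedding.ofMapLEIff f h) hs

open Classical in
/-- The lower sets of a poset with a new top element. -/
noncomputable def lowerSetWithTop (X : Type*) [PartialOrder X] :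
    LowerSet (WithTop X) ≃o OrdSum (LowerSet X) Bool :=
  orderIsoOfSurjective
    (fun S => ⟨(⟨{x | (x : WithTop X) ∈ S}, fun _ _ hab ha => S.lower (WithTop.coe_le_coe.2 hab) ha⟩,
      decide (⊤ ∈ S)), by
      by_cases h : ⊤ ∈ S
      · exact Or.inl (LowerSet.ext (Set.eq_univ_of_forall fun x => S.lower le_top h))
      · exact Or.inr (by simp [h])⟩)
    (fun S T => by
      refine OrdSum.le_def.trans ?_
      constructor
      · rintro ⟨h1, h2⟩ x hx
        induction x using WithTop.recTopCoe with
        | top =>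
          have := h2
          simp only [Bool.le_iff_imp, decide_eq_true_eq] at this
          exact this hx
        | coe x => exact h1 hx
      · intro h
        refine ⟨fun x hx => h hx, ?_⟩
        simp only [Bool.le_iff_imp, decide_eq_true_eq]
        exact fun hx => h hx)
    (by
      rintro ⟨⟨V, b⟩, hV⟩
      refine ⟨⟨{y | (∃ a ∈ V, y = a) ∨ (y = ⊤ ∧ b = true)}, ?_⟩, ?_⟩
      · rintro x y hyx (⟨a, ha, rfl⟩ | ⟨rfl, hb⟩)
        · obtain ⟨c, rfl, hca⟩ := WithTop.le_coe_iff.1 hyx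
          exact Or.inl ⟨c, V.lower hca ha, rfl⟩
        · induction y using WithTop.recTopCoe with
          | top => exact Or.inr ⟨rfl, hb⟩
          | coe y =>
            have hV : V = ⊤ := hV.resolve_right (by simp [hb])
            exact Or.inl ⟨y, by rw [hV]; trivial, rfl⟩
      · refine Subtype.ext (Prod.ext (LowerSet.ext (Set.ext fun x => ?_)) ?_)
        · simp [← SetLike.mem_coe]
        · simp [← SetLike.mem_coe])

open Classical in
/-- The lower sets of a poset with a new bottom element. -/
noncomputable def lowerSetWithBot (X : Type*) [PartialOrder X] :
    LowerSet (WithBot X) ≃o OrdSum Bool (LowerSet X) :=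
  orderIsoOfSurjective
    (fun S => ⟨(decide (⊥ ∈ S),
      ⟨{x | (x : WithBot X) ∈ S}, fun _ _ hab ha => S.lower (WithBot.coe_le_coe.2 hab) ha⟩), by
      by_cases h : ⊥ ∈ S
      · exact Or.inl (by simp [h])
      · exact Or.inr (LowerSet.ext (Set.eq_empty_of_forall_notMem fun x hx =>
          h (S.lower bot_le hx)))⟩)
    (fun S T => by
      refine OrdSum.le_def.trans ?_
      constructor
      · rintro ⟨h2, h1⟩ x hx
        induction x using WithBot.recBotCoe with
        | bot =>
          have := h2
          simp only [Bool.le_iff_imp, decide_eq_true_eq] at this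
          exact this hx
        | coe x => exact h1 hx
      · intro h
        refine ⟨?_, fun x hx => h hx⟩
        simp only [Bool.le_iff_imp, decide_eq_true_eq]
        exact fun hx => h hx)
    (by
      rintro ⟨⟨b, V⟩, hV⟩
      refine ⟨⟨{y | (∃ a ∈ V, y = a) ∨ (y = ⊥ ∧ b = true)}, ?_⟩, ?_⟩
      · rintro x y hyx (⟨a, ha, rfl⟩ | ⟨rfl, hb⟩)
        · induction y using WithBot.recBotCoe with
          | bot =>
            refine Or.inr ⟨rfl, hV.resolve_right fun h => ?_⟩
            change V = ⊥ at h
            rw [h] at ha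
            exact ha
          | coe y => exact Or.inl ⟨y, V.lower (WithBot.coe_le_coe.1 hyx) ha, rfl⟩
        · exact Or.inr ⟨le_bot_iff.1 hyx, hb⟩
      · refine Subtype.ext (Prod.ext ?_ (LowerSet.ext (Set.ext fun x => ?_)))
        · simp [← SetLike.mem_coe]
        · simp [← SetLike.mem_coe])

/-- The two-element antichain. -/
inductive AntichainTwo : Type
  | a | b

instance : PartialOrder AntichainTwo where
  le x y := x = y
  le_refl _ := rfl
  le_trans _ _ _ h h' := h.trans h'
  le_antisymm _ _ h _ := h

/-- The three-element antichain. -/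
inductive AntichainThree : Type
  | a | b | c

instance : PartialOrder AntichainThree where
  le x y := x = y
  le_refl _ := rfl
  le_trans _ _ _ h h' := h.trans h'
  le_antisymm _ _ h _ := h

/-- The disjoint union of a point and a two-element chain. -/
inductive PosetZ6 : Type
  | p | q | r

instance : PartialOrder PosetZ6 where
  le x y := x = y ∨ (x = .q ∧ y = .r)
  le_refl _ := Or.inl rfl
  le_trans x y z := by cases x <;> cases y <;> cases z <;> simp
  le_antisymm x y := by cases x <;> cases y <;> simp

instance : Finite AntichainTwo :=
  Finite.of_surjective (fun b : Bool => if b then .a else .b)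
    (by rintro (_ | _); exacts [⟨true, rfl⟩, ⟨false, rfl⟩])

instance : Finite PosetZ6 :=
  Finite.of_surjective (![.p, .q, .r] : Fin 3 → PosetZ6)
    (by rintro (_ | _ | _); exacts [⟨0, rfl⟩, ⟨1, rfl⟩, ⟨2, rfl⟩])

instance : Finite PosetZ8 :=
  Finite.of_surjective (![.p, .q, .r, .s] : Fin 4 → PosetZ8)
    (by rintro (_ | _ | _ | _); exacts [⟨0, rfl⟩, ⟨1, rfl⟩, ⟨2, rfl⟩, ⟨3, rfl⟩])

open Classical in
/-- The lower sets of a point. -/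
noncomputable def lowerSetUnit : LowerSet Unit ≃o Bool :=
  orderIsoOfSurjective (fun S => decide (() ∈ S))
    (fun S T => by
      simp only [Bool.le_iff_imp, decide_eq_true_eq]
      exact ⟨fun h _ hx => h hx, fun h hx => h hx⟩)
    (by
      rintro (_ | _)
      · exact ⟨⊥, decide_eq_false id⟩
      · exact ⟨⊤, decide_eq_true trivial⟩)

open Classical in
/-- The lower sets of the two-element antichain. -/
noncomputable def lowerSetAntichainTwo : LowerSet AntichainTwo ≃o Bool × Bool :=
  orderIsoOfSurjective (fun S => (decide (.a ∈ S), decide (.b ∈ S)))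
    (fun S T => by
      simp only [Prod.mk_le_mk, Bool.le_iff_imp, decide_eq_true_eq]
      refine ⟨fun h x hx => ?_, fun h => ⟨fun hx => h hx, fun hx => h hx⟩⟩
      cases x
      exacts [h.1 hx, h.2 hx])
    (by
      rintro ⟨s, t⟩
      refine ⟨⟨{x | (x = .a ∧ s = true) ∨ (x = .b ∧ t = true)}, ?_⟩, ?_⟩
      · rintro x _ rfl h
        exact h
      · refine Prod.ext ?_ ?_ <;> rw [Bool.eq_iff_iff, decide_eq_true_iff] <;>
          change (_ ∧ _) ∨ (_ ∧ _) ↔ _ <;> simp)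

open Classical in
/-- The lower sets of the three-element antichain. -/
noncomputable def lowerSetAntichainThree : LowerSet AntichainThree ≃o Bool × Bool × Bool :=
  orderIsoOfSurjective (fun S => (decide (.a ∈ S), decide (.b ∈ S), decide (.c ∈ S)))
    (fun S T => by
      simp only [Prod.mk_le_mk, Bool.le_iff_imp, decide_eq_true_eq]
      refine ⟨fun h x hx => ?_, fun h => ⟨fun hx => h hx, fun hx => h hx, fun hx => h hx⟩⟩
      cases x
      exacts [h.1 hx, h.2.1 hx, h.2.2 hx])
    (by
      rintro ⟨s, t, u⟩
      refine ⟨⟨{x | (x = .a ∧ s = true) ∨ (x = .b ∧ t = true) ∨ (x = .c ∧ u = true)}, ?_⟩, ?_⟩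
      · rintro x _ rfl h
        exact h
      · refine Prod.ext ?_ (Prod.ext ?_ ?_) <;> rw [Bool.eq_iff_iff, decide_eq_true_iff] <;>
          change (_ ∧ _) ∨ (_ ∧ _) ∨ (_ ∧ _) ↔ _ <;> simp)

/-- The lower sets of the disjoint union of a point and a two-element chain. -/
noncomputable def lowerSetPosetZ6 : Bool × Fin 3 ≃o LowerSet PosetZ6 :=
  orderIsoOfSurjective
    (fun x => ⟨{y | (y = .p ∧ x.1 = true) ∨ (y = .q ∧ 1 ≤ x.2) ∨ (y = .r ∧ 2 ≤ x.2)}, by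
      rintro y z (rfl | ⟨rfl, rfl⟩) h
      · exact h
      · simp only [reduceCtorEq, false_and, true_and, false_or, or_false, Set.mem_ofPred_eq] at h ⊢
        exact le_trans (by decide) h⟩)
    (by
      intro x y
      constructor
      · intro h
        obtain ⟨x, i⟩ := x
        obtain ⟨y, j⟩ := y
        have hp : x = true → y = true := fun hx => by
          rcases h (Or.inl ⟨rfl, hx⟩ : PosetZ6.p ∈ _) with ⟨-, h⟩ | ⟨h, -⟩ | ⟨h, -⟩
          exacts [h, absurd h (by simp), absurd h (by simp)]
        have hq : 1 ≤ i → 1 ≤ j := fun hx => by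
          rcases h (Or.inr (Or.inl ⟨rfl, hx⟩) : PosetZ6.q ∈ _) with ⟨h, -⟩ | ⟨-, h⟩ | ⟨h, -⟩
          exacts [absurd h (by simp), h, absurd h (by simp)]
        have hr : 2 ≤ i → 2 ≤ j := fun hx => by
          rcases h (Or.inr (Or.inr ⟨rfl, hx⟩) : PosetZ6.r ∈ _) with ⟨h, -⟩ | ⟨h, -⟩ | ⟨-, h⟩
          exacts [absurd h (by simp), absurd h (by simp), h]
        refine ⟨Bool.le_iff_imp.2 hp, ?_⟩
        clear h hp
        change i ≤ j
        revert i j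
        decide
      · rintro ⟨h1, h2⟩ z (⟨rfl, h⟩ | ⟨rfl, h⟩ | ⟨rfl, h⟩)
        · exact Or.inl ⟨rfl, Bool.le_iff_imp.1 h1 h⟩
        · exact Or.inr (Or.inl ⟨rfl, h.trans h2⟩)
        · exact Or.inr (Or.inr ⟨rfl, h.trans h2⟩))
    (by
      classical
      intro S
      have hqr : PosetZ6.r ∈ S → PosetZ6.q ∈ S := S.lower (Or.inr ⟨rfl, rfl⟩)
      refine ⟨(decide (.p ∈ S), if .r ∈ S then 2 else if .q ∈ S then 1 else 0), ?_⟩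
      refine LowerSet.ext (Set.ext fun y => ?_)
      cases y <;> by_cases hr : PosetZ6.r ∈ S <;> by_cases hq : PosetZ6.q ∈ S <;> simp_all)

theorem not_omitsProhibited_Z6 : ¬ OmitsProhibited (LowerSet (WithTop PosetZ6)) :=
  not_omitsProhibited_of_orderIso 0 <|
    (lowerSetWithTop _).trans (OrdSum.congr lowerSetPosetZ6.symm (OrderIso.refl Bool))

theorem not_omitsProhibited_two_add_Z6 :
    ¬ OmitsProhibited (LowerSet (WithBot (WithTop PosetZ6))) :=
  not_omitsProhibited_of_orderIso 1 <|
    (lowerSetWithBot _).trans (OrdSum.congr (OrderIso.refl Bool)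
      ((lowerSetWithTop _).trans (OrdSum.congr lowerSetPosetZ6.symm (OrderIso.refl Bool))))

theorem not_omitsProhibited_three : ¬ OmitsProhibited (LowerSet (WithTop AntichainThree)) :=
  not_omitsProhibited_of_orderIso 2 <|
    (lowerSetWithTop _).trans (OrdSum.congr lowerSetAntichainThree (OrderIso.refl Bool))

theorem not_omitsProhibited_two_add_three :
    ¬ OmitsProhibited (LowerSet (WithBot (WithTop AntichainThree))) :=
  not_omitsProhibited_of_orderIso 3 <|
    (lowerSetWithBot _).trans (OrdSum.congr (OrderIso.refl Bool)
      ((lowerSetWithTop _).trans (OrdSum.congr lowerSetAntichainThree (OrderIso.refl Bool))))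

theorem not_omitsProhibited_D : ¬ OmitsProhibited (LowerSet (WithTop PosetD)) :=
  not_omitsProhibited_of_orderIso 4 (lowerSetWithTop _)

/-! ### Intervals in Heyting algebras -/

section Intervals

variable {A B : Type*} [HeytingAlgebra A] [HeytingAlgebra B]

instance Set.Iic.instHeytingAlgebra (s : A) : HeytingAlgebra (Set.Iic s) :=
  { (inferInstance : Lattice (Set.Iic s)), (inferInstance : BoundedOrder (Set.Iic s)) with
    himp x y := ⟨(x.1 ⇨ y.1) ⊓ s, inf_le_right⟩
    compl x := ⟨x.1ᶜ ⊓ s, inf_le_right⟩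
    le_himp_iff x y z := by
      change x.1 ≤ (y.1 ⇨ z.1) ⊓ s ↔ x.1 ⊓ y.1 ≤ z.1
      rw [le_inf_iff, le_himp_iff]
      exact and_iff_left x.2
    himp_bot x := Subtype.ext (congrArg (· ⊓ s) (himp_bot x.1)) }

instance Set.Ici.instHeytingAlgebra (c : A) : HeytingAlgebra (Set.Ici c) :=
  { (inferInstance : Lattice (Set.Ici c)), (inferInstance : OrderTop (Set.Ici c)),
    (inferInstance : OrderBot (Set.Ici c)) with
    himp x y := ⟨x.1 ⇨ y.1, le_trans (Set.mem_Ici.1 y.2) le_himp⟩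
    compl x := ⟨x.1 ⇨ c, le_himp⟩
    le_himp_iff x y z := le_himp_iff (a := x.1) (b := y.1) (c := z.1)
    himp_bot _ := rfl }

/-- The quotient by a principal filter. -/
noncomputable def restrictIic (s : A) : HeytingHom A (Set.Iic s) where
  toFun x := ⟨x ⊓ s, inf_le_right⟩
  map_sup' x y := Subtype.ext (inf_sup_right x y s)
  map_inf' x y := Subtype.ext (inf_inf_distrib_right x y s)
  map_bot' := Subtype.ext (bot_inf_eq s)
  map_himp' x y := by
    refine Subtype.ext ?_
    change (x ⇨ y) ⊓ s = (x ⊓ s ⇨ y ⊓ s) ⊓ s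
    refine eq_of_forall_le_iff fun w => ?_
    simp only [le_inf_iff, le_himp_iff]
    constructor
    · rintro ⟨h1, h2⟩
      exact ⟨⟨(inf_le_inf_left w inf_le_left).trans h1, inf_le_left.trans h2⟩, h2⟩
    · rintro ⟨⟨h1, -⟩, h2⟩
      refine ⟨le_trans ?_ h1, h2⟩
      exact le_inf inf_le_left (le_inf inf_le_right (inf_le_left.trans h2))

theorem restrictIic_surjective (s : A) : Function.Surjective (restrictIic s) :=
  fun x => ⟨x.1, Subtype.ext (inf_of_le_left x.2)⟩

theorem isBrouwerianHom_coe_Ici (c : A) : IsBrouwerianHom (Subtype.val : Set.Ici c → A) :=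
  ⟨fun _ _ => rfl, fun _ _ => rfl, fun _ _ => rfl⟩

/-- A homomorphism maps principal filters to principal filters. -/
noncomputable def HeytingHom.mapIci (h : HeytingHom A B) (c : A) :
    HeytingHom (Set.Ici c) (Set.Ici (h c)) where
  toFun x := ⟨h x.1, OrderHomClass.mono h x.2⟩
  map_sup' x y := Subtype.ext (map_sup h x.1 y.1)
  map_inf' x y := Subtype.ext (map_inf h x.1 y.1)
  map_bot' := rfl
  map_himp' x y := Subtype.ext (map_himp h x.1 y.1)

theorem HeytingHom.mapIci_surjective {h : HeytingHom A B} (hs : Function.Surjective h) (c : A) :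
    Function.Surjective (h.mapIci c) := by
  rintro ⟨y, hy⟩
  obtain ⟨x, rfl⟩ := hs y
  refine ⟨⟨x ⊔ c, le_sup_right⟩, Subtype.ext ?_⟩
  change h (x ⊔ c) = h x
  rw [map_sup]
  exact sup_of_le_left hy

/-- A map that preserves all operations except the bottom element is a homomorphism to a
principal filter. -/
noncomputable def IsBrouwerianHom.toIci {f : A → B} (hf : IsBrouwerianHom f) {c : B}
    (hc : f ⊥ = c) : HeytingHom A (Set.Ici c) where
  toFun x := ⟨f x, hc ▸ hf.mono bot_le⟩
  map_sup' x y := Subtype.ext (hf.map_sup x y)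
  map_inf' x y := Subtype.ext (hf.map_inf x y)
  map_bot' := Subtype.ext hc
  map_himp' x y := Subtype.ext (hf.map_himp x y)

end Intervals

/-! ### The Scott identity -/

theorem PosetZ6.le_iff {x y : PosetZ6} : x ≤ y ↔ x = y ∨ (x = .q ∧ y = .r) := Iff.rfl

theorem PosetZ6.lt_iff {x y : PosetZ6} : x < y ↔ x = .q ∧ y = .r := by
  rw [lt_iff_le_and_ne, le_iff]
  cases x <;> cases y <;> simp

theorem PosetZ8.le_iff {x y : PosetZ8} : x ≤ y ↔
    x = y ∨ (x = .q ∧ y = .r) ∨ (x = .p ∧ y = .s) ∨ (x = .q ∧ y = .s) := Iff.rfl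

theorem PosetZ8.lt_iff {x y : PosetZ8} : x < y ↔
    (x = .q ∧ y = .r) ∨ (x = .p ∧ y = .s) ∨ (x = .q ∧ y = .s) := by
  rw [lt_iff_le_and_ne, le_iff]
  cases x <;> cases y <;> simp

section Scott

variable {A : Type*} [HeytingAlgebra A]

/-- If the conclusion fails, `xᶜ`, `x`, `xᶜᶜ` serve as the points `p`, `q`, `r` of `PosetZ6` and
generate a copy of P₁. The hypothesis is exactly the implication inequality at `r`; any coincidence
between the generated elements would force `xᶜ ⊔ xᶜᶜ = ⊤`. -/
theorem OmitsProhibited.weak_excluded_middle (h : OmitsProhibited A) {x : A}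
    (hx : xᶜᶜ ⇨ x ≤ x ⊔ xᶜ) : xᶜ ⊔ xᶜᶜ = ⊤ := by
  by_contra htop
  let e : PosetZ6 → A := fun y => PosetZ6.casesOn y xᶜ x xᶜᶜ
  have he : IsPartialHeytingHom (joinOf e) := by
    refine isPartialHeytingHom_joinOf ?_ ?_
    · intro y z hyz hzy
      cases y <;> cases z <;>
        first
        | exact absurd le_rfl hyz
        | exact absurd (Or.inr ⟨rfl, rfl⟩) hyz
        | exact absurd (Or.inr ⟨rfl, rfl⟩) hzy
        | (refine le_trans (le_of_eq ?_) bot_le; simp [e])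
    · intro y
      cases y
      · refine (himp_le_himp_left (joinOf_Iio_le_bot (by simp [PosetZ6.lt_iff]))).trans ?_
        rw [himp_bot]
        exact le_joinOf (e := e) (y := PosetZ6.r) (LowerSet.mem_compl_Ici_iff.2 (by simp [PosetZ6.le_iff]))
      · refine (himp_le_himp_left (joinOf_Iio_le_bot (by simp [PosetZ6.lt_iff]))).trans ?_
        rw [himp_bot]
        exact le_joinOf (e := e) (y := PosetZ6.p) (LowerSet.mem_compl_Ici_iff.2 (by simp [PosetZ6.le_iff]))
      · have hr : joinOf e (LowerSet.Iio .r) ≤ x := by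
          refine joinOf_le_iff.2 fun z hz => ?_
          obtain rfl := (PosetZ6.lt_iff.1 hz).1
          exact le_rfl
        refine (himp_le_himp_left hr).trans (hx.trans (sup_le ?_ ?_))
        · exact le_joinOf (e := e) (y := PosetZ6.q) (LowerSet.mem_compl_Ici_iff.2 (by simp [PosetZ6.le_iff]))
        · exact le_joinOf (e := e) (y := PosetZ6.p) (LowerSet.mem_compl_Ici_iff.2 (by simp [PosetZ6.le_iff]))
  have hinj : ∀ y, ¬ e y ≤ joinOf e (UpperSet.Ici y).compl := by
    intro y hy
    cases y
    · have h1 : joinOf e (UpperSet.Ici PosetZ6.p).compl ≤ xᶜᶜ := by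
        refine joinOf_le_iff.2 fun z hz => ?_
        cases z
        exacts [absurd le_rfl (LowerSet.mem_compl_Ici_iff.1 hz), le_compl_compl, le_rfl]
      have h2 : xᶜ = ⊥ := by
        have := le_inf (le_refl xᶜ) (hy.trans h1)
        simpa using this
      exact htop (by simp [h2])
    · have h1 : joinOf e (UpperSet.Ici PosetZ6.q).compl ≤ xᶜ := by
        refine joinOf_le_iff.2 fun z hz => ?_
        cases z
        exacts [le_rfl, absurd le_rfl (LowerSet.mem_compl_Ici_iff.1 hz), absurd (Or.inr ⟨rfl, rfl⟩) (LowerSet.mem_compl_Ici_iff.1 hz)]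
      have h2 : x = ⊥ := by
        have := le_inf (le_refl x) (hy.trans h1)
        simpa using this
      exact htop (by simp [h2])
    · have h1 : joinOf e (UpperSet.Ici PosetZ6.r).compl ≤ x ⊔ xᶜ := by
        refine joinOf_le_iff.2 fun z hz => ?_
        cases z
        exacts [le_sup_right, le_sup_left, absurd le_rfl (LowerSet.mem_compl_Ici_iff.1 hz)]
      have h2 : xᶜᶜ ≤ x := by
        have := le_inf (hy.trans h1) (le_refl xᶜᶜ)
        rw [inf_sup_right, inf_compl_self, sup_bot_eq] at this
        exact this.trans inf_le_left
      rw [himp_eq_top_iff.2 h2, top_le_iff] at hx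
      refine htop (top_le_iff.1 (hx.ge.trans ?_))
      rw [sup_comm]
      exact sup_le_sup_left le_compl_compl _
  have ht : joinOf e ⊤ ≠ ⊤ := by
    intro h'
    refine htop (top_le_iff.1 (h'.ge.trans (joinOf_le_iff.2 fun y _ => ?_)))
    cases y
    exacts [le_sup_left, le_compl_compl.trans le_sup_right, le_sup_right]
  refine not_omitsProhibited_Z6 ?_
  refine (h.addTwo_of_partial he (fun S T hST => ?_) ht).of_orderIso (lowerSetWithTop _)
  exact le_antisymm ((joinOf_le_joinOf_iff hinj).1 hST.le) ((joinOf_le_joinOf_iff hinj).1 hST.ge)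

/-- In the quotient by the filter generated by the left side `s`, the hypothesis of
`weak_excluded_middle` becomes true; its conclusion there says that `s` lies below the right side.
-/
theorem OmitsProhibited.scott (h : OmitsProhibited A) (a : A) :
    (aᶜᶜ ⇨ a) ⇨ (a ⊔ aᶜ) ≤ aᶜ ⊔ aᶜᶜ := by
  set s := (aᶜᶜ ⇨ a) ⇨ (a ⊔ aᶜ)
  have h1 := (h.of_surjective _ (restrictIic_surjective s)).weak_excluded_middle
    (x := restrictIic s a) ?_
  · simp only [← map_compl, ← map_sup] at h1
    have h2 : (aᶜ ⊔ aᶜᶜ) ⊓ s = s := congrArg Subtype.val h1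
    exact inf_eq_right.1 h2
  · rw [← himp_eq_top_iff]
    simp only [← map_compl, ← map_himp, ← map_sup]
    exact Subtype.ext (inf_idem s)

end Scott

/-! ### Lifting homomorphisms -/

/-- Homomorphisms from `P` to homomorphic images of `A` lift to `A`. -/
def HasLift (P : Type*) [HeytingAlgebra P] (A : Type u) [HeytingAlgebra A] : Prop :=
  ∀ (B : Type u) [HeytingAlgebra B] (h : HeytingHom A B), Function.Surjective h →
    ∀ f : HeytingHom P B, ∃ g : HeytingHom P A, h.comp g = f

section Lift

variable {P Q C D : Type*} [HeytingAlgebra P] [HeytingAlgebra Q] [HeytingAlgebra C]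
  [HeytingAlgebra D] {A : Type u} [HeytingAlgebra A]

theorem HasLift.of_orderIso (h : HasLift P A) (e : Q ≃o P) : HasLift Q A := by
  intro B _ k hk f
  obtain ⟨g, hg⟩ := h B k hk (f.comp (e.symm : HeytingHom P Q))
  refine ⟨g.comp (e : HeytingHom Q P), ?_⟩
  ext x
  have := DFunLike.congr_fun hg (e x)
  change k (g (e x)) = f (e.symm (e x)) at this
  rwa [e.symm_apply_apply] at this

/-- With `c` the lifted gluing point, the part on `D` is lifted through the surjection from `[c, ⊤]`
to `[h c, ⊤]`. As `[c, ⊤]` need not inherit properties of `A`, liftability of `D` is demanded for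
all algebras. -/
theorem HasLift.ordSum (hC : HasLift (OrdSum C Bool) A)
    (hD : ∀ (B : Type u) [HeytingAlgebra B], HasLift D B) : HasLift (OrdSum C D) A := by
  intro B _ h hs f
  obtain ⟨g, hg⟩ := hC B h hs (f.comp OrdSum.isPartialHeytingHom_inl.addTwo)
  have hg' : ∀ x, h (g (OrdSum.inl x)) = f (OrdSum.inl x) := by
    intro x
    have := DFunLike.congr_fun hg (OrdSum.inl x)
    simpa [IsPartialHeytingHom.addTwo_inl] using this
  set c := g (OrdSum.inl ⊤) with hc
  have hf : IsBrouwerianHom (f ∘ OrdSum.inr) := f.isBrouwerianHom.comp OrdSum.isBrouwerianHom_inr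
  obtain ⟨k, hk⟩ := hD (Set.Ici c) (Set.Ici (h c)) (h.mapIci c) (HeytingHom.mapIci_surjective hs c)
    (hf.toIci (c := h c) (hg' ⊤).symm)
  have hk' : ∀ y, h (k y).1 = f (OrdSum.inr y) := fun y =>
    congrArg Subtype.val (DFunLike.congr_fun hk y)
  refine ⟨OrdSum.lift (g.comp_isPartialHeytingHom OrdSum.isPartialHeytingHom_inl)
    ((isBrouwerianHom_coe_Ici c).comp k.isBrouwerianHom) ?_, OrdSum.hom_ext ?_ ?_⟩
  · simp [hc]
  · intro a
    simp [OrdSum.lift_inl, hg']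
  · intro b
    simp [OrdSum.lift_inr, hk']

theorem IsPartialHeytingHom.map_compl {f : P → Q} (hf : IsPartialHeytingHom f) {a : P}
    (ha : a ≠ ⊥) : f aᶜ = (f a)ᶜ := by
  rw [← himp_bot, hf.map_himp a ⊥ fun h => ha (le_bot_iff.1 h), hf.map_bot, himp_bot]

theorem IsPartialHeytingHom.map_joinOf {Y : Type*} [PartialOrder Y] [Finite Y] {f : P → Q}
    (hf : IsPartialHeytingHom f) (e : Y → P) (S : LowerSet Y) :
    f (joinOf e S) = joinOf (f ∘ e) S :=
  Finset.apply_sup_eq_sup_comp f hf.map_sup hf.map_bot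

/-- It suffices to lift the join-irreducible elements. -/
theorem hasLift_of_generators {Y : Type*} [PartialOrder Y] [Finite Y]
    (H : ∀ (B : Type u) [HeytingAlgebra B] (h : HeytingHom A B), Function.Surjective h →
      ∀ f : LowerSet Y → B, IsPartialHeytingHom f →
      ∃ e : Y → A, IsPartialHeytingHom (joinOf e) ∧ ∀ y, h (e y) = f (LowerSet.Iic y)) :
    HasLift (OrdSum (LowerSet Y) Bool) A := by
  intro B _ h hs f
  obtain ⟨e, he, hef⟩ := H B h hs (f ∘ OrdSum.inl)
    (f.comp_isPartialHeytingHom OrdSum.isPartialHeytingHom_inl)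
  have key : ∀ S, (h.comp he.addTwo) (OrdSum.inl S) = f (OrdSum.inl S) := by
    intro S
    change h (he.addTwo (OrdSum.inl S)) = _
    rw [he.addTwo_inl, _root_.map_joinOf]
    conv_rhs => rw [← joinOf_Iic S]
    rw [show f (OrdSum.inl (joinOf LowerSet.Iic S)) = (f ∘ OrdSum.inl) (joinOf LowerSet.Iic S)
      from rfl, (f.comp_isPartialHeytingHom OrdSum.isPartialHeytingHom_inl).map_joinOf]
    congr 1
    exact funext hef
  refine ⟨he.addTwo, OrdSum.hom_ext key fun b => ?_⟩
  cases b
  · exact key ⊤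
  · exact (map_top (h.comp he.addTwo)).trans (map_top f).symm

theorem hasLift_unit : HasLift (OrdSum (LowerSet Unit) Bool) A := by
  refine hasLift_of_generators fun B _ h hs f hf => ?_
  obtain ⟨a, ha⟩ := hs (f ⊤)
  -- The generator must go to a dense element. Since `f ⊤` is already dense, `h` sends `a ⊔ aᶜ` to
  -- the same place as `a`.
  refine ⟨fun _ => a ⊔ aᶜ, isPartialHeytingHom_joinOf (fun x y hxy => absurd le_rfl hxy) ?_, ?_⟩
  · intro x
    refine (himp_le_himp_left (joinOf_Iio_le_bot fun y => lt_irrefl y)).trans ?_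
    simp
  · intro y
    have h1 : (⊤ : LowerSet Unit) ≠ ⊥ := fun h' => by
      have : () ∈ (⊥ : LowerSet Unit) := h' ▸ trivial
      exact this
    have h2 : LowerSet.Iic y = ⊤ := top_le_iff.1 fun _ _ => le_refl y
    rw [map_sup, map_compl, ha, ← hf.map_compl h1, compl_top, hf.map_bot, sup_bot_eq, h2]

/-- The two atoms are complements of each other, and so are their images under `f`. Replacing a
preimage `a` of the first by `aᶜᶜ` and taking `aᶜ` for the second makes the lifts complements of
each other too. -/
theorem hasLift_antichainTwo : HasLift (OrdSum (LowerSet AntichainTwo) Bool) A := by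
  refine hasLift_of_generators fun B _ h hs f hf => ?_
  obtain ⟨a, ha⟩ := hs (f (LowerSet.Iic .a))
  let e : AntichainTwo → A := fun y => AntichainTwo.casesOn y aᶜᶜ aᶜ
  refine ⟨e, isPartialHeytingHom_joinOf ?_ ?_, ?_⟩
  · intro x y hxy _
    cases x <;> cases y <;> first
      | exact absurd le_rfl hxy
      | (refine le_trans (le_of_eq ?_) bot_le; simp [e])
  · intro x
    refine (himp_le_himp_left (joinOf_Iio_le_bot fun y hy => hy.ne hy.le)).trans ?_
    rw [himp_bot]
    cases x
    · refine le_trans (le_of_eq ?_) (le_joinOf (e := e) (y := AntichainTwo.b)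
        (LowerSet.mem_compl_Ici_iff.2 fun h => nomatch h))
      simp [e]
    · exact le_joinOf (e := e) (y := AntichainTwo.a)
        (LowerSet.mem_compl_Ici_iff.2 fun h => nomatch h)
  · have hne : ∀ y : AntichainTwo, LowerSet.Iic y ≠ ⊥ := fun y h => by
      have : y ∈ (⊥ : LowerSet AntichainTwo) := h ▸ le_refl y
      exact this
    have hab : (LowerSet.Iic AntichainTwo.a)ᶜ = LowerSet.Iic .b := by
      ext x
      refine LowerSet.mem_compl_iff_forall.trans ⟨fun h => ?_, ?_⟩
      · cases x
        exacts [(h .a le_rfl (le_refl AntichainTwo.a)).elim, le_refl AntichainTwo.b]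
      · rintro rfl y rfl h
        exact nomatch h
    have hba : (LowerSet.Iic AntichainTwo.b)ᶜ = LowerSet.Iic .a := by
      ext x
      refine LowerSet.mem_compl_iff_forall.trans ⟨fun h => ?_, ?_⟩
      · cases x
        exacts [le_refl AntichainTwo.a, (h .b le_rfl (le_refl AntichainTwo.b)).elim]
      · rintro rfl y rfl h
        exact nomatch h
    have h1 : h aᶜ = f (LowerSet.Iic .b) := by
      rw [map_compl, ha, ← hf.map_compl (hne _), hab]
    intro y
    cases y
    · change h aᶜᶜ = _
      rw [map_compl, h1, ← hf.map_compl (hne _), hba]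
    · exact h1

/-- The algebra is generated by `q`, with `p = qᶜ`, `r = qᶜᶜ` and `s = qᶜᶜ ⇨ q`, so one preimage `a`
of `q` determines the lift. All required inequalities hold in every Heyting algebra except the one
at `s`, which is Scott's. -/
theorem OmitsProhibited.hasLift_Z8 (hA : OmitsProhibited A) :
    HasLift (OrdSum (LowerSet PosetZ8) Bool) A := by
  refine hasLift_of_generators fun B _ h hs f hf => ?_
  obtain ⟨a, ha⟩ := hs (f (LowerSet.Iic .q))
  let e : PosetZ8 → A := fun y => PosetZ8.casesOn y aᶜ a aᶜᶜ (aᶜᶜ ⇨ a)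
  refine ⟨e, isPartialHeytingHom_joinOf ?_ ?_, ?_⟩
  · have hrs : aᶜᶜ ⊓ (aᶜᶜ ⇨ a) ≤ joinOf e (LowerSet.Iic .r ⊓ LowerSet.Iic .s) := by
      refine inf_himp_le.trans (le_joinOf (e := e) (y := PosetZ8.q) ?_)
      exact ⟨by simp [PosetZ8.le_iff], by simp [PosetZ8.le_iff]⟩
    intro x y hxy hyx
    rw [PosetZ8.le_iff] at hxy hyx
    cases x <;> cases y <;> first
      | (exfalso; simp at hxy; done)
      | (exfalso; simp at hyx; done)
      | exact hrs
      | (rw [inf_comm, inf_comm (LowerSet.Iic _)]; exact hrs)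
      | (refine le_trans (le_of_eq ?_) bot_le
         simp [e])
  · intro x
    cases x
    · refine (himp_le_himp_left (joinOf_Iio_le_bot (by simp [PosetZ8.lt_iff]))).trans ?_
      rw [himp_bot]
      exact le_joinOf (e := e) (y := PosetZ8.r) (LowerSet.mem_compl_Ici_iff.2 (by simp [PosetZ8.le_iff]))
    · refine (himp_le_himp_left (joinOf_Iio_le_bot (by simp [PosetZ8.lt_iff]))).trans ?_
      rw [himp_bot]
      exact le_joinOf (e := e) (y := PosetZ8.p) (LowerSet.mem_compl_Ici_iff.2 (by simp [PosetZ8.le_iff]))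
    · have : joinOf e (LowerSet.Iio .r) ≤ a := joinOf_le_iff.2 fun y hy => by
        obtain rfl : y = .q := by simpa [PosetZ8.lt_iff] using hy
        exact le_rfl
      refine (himp_le_himp_left this).trans ?_
      exact le_joinOf (e := e) (y := PosetZ8.s) (LowerSet.mem_compl_Ici_iff.2 (by simp [PosetZ8.le_iff]))
    · have : joinOf e (LowerSet.Iio .s) ≤ a ⊔ aᶜ := joinOf_le_iff.2 fun y hy => by
        obtain rfl | rfl : y = .p ∨ y = .q := by simpa [PosetZ8.lt_iff] using hy
        exacts [le_sup_right, le_sup_left]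
      refine (himp_le_himp_left this).trans ((hA.scott a).trans (sup_le ?_ ?_))
      · exact le_joinOf (e := e) (y := PosetZ8.p) (LowerSet.mem_compl_Ici_iff.2 (by simp [PosetZ8.le_iff]))
      · exact le_joinOf (e := e) (y := PosetZ8.r) (LowerSet.mem_compl_Ici_iff.2 (by simp [PosetZ8.le_iff]))
  · have hne : ∀ y : PosetZ8, LowerSet.Iic y ≠ ⊥ := fun y h => by
      have : y ∈ (⊥ : LowerSet PosetZ8) := h ▸ le_refl y
      exact this
    have hp : (LowerSet.Iic PosetZ8.q)ᶜ = LowerSet.Iic .p := by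
      ext x
      refine LowerSet.mem_compl_iff_forall.trans ?_
      cases x <;> simp [PosetZ8.le_iff]
    have hr : (LowerSet.Iic PosetZ8.p)ᶜ = LowerSet.Iic .r := by
      ext x
      refine LowerSet.mem_compl_iff_forall.trans ?_
      cases x <;> simp [PosetZ8.le_iff]
    have hs : LowerSet.Iic PosetZ8.r ⇨ LowerSet.Iic .q = LowerSet.Iic .s := by
      ext x
      refine LowerSet.mem_himp_iff.trans ?_
      cases x <;> simp [PosetZ8.le_iff]
    have h1 : h aᶜ = f (LowerSet.Iic .p) := by
      rw [map_compl, ha, ← hf.map_compl (hne _), hp]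
    have h2 : h aᶜᶜ = f (LowerSet.Iic .r) := by
      rw [map_compl, h1, ← hf.map_compl (hne _), hr]
    have h3 : h (aᶜᶜ ⇨ a) = f (LowerSet.Iic .s) := by
      rw [map_himp, h2, ha, ← hf.map_himp _ _ ?_, hs]
      rw [LowerSet.Iic_le]
      simp [PosetZ8.le_iff]
    intro y
    cases y
    exacts [h1, ha, h2, h3]

end Lift

/-! ### Finite posets whose algebras omit the prohibited algebras -/

section Transfer

variable {X Q : Type*} [PartialOrder X] [PartialOrder Q]

theorem IsPMorphism.of_monotone {f : X → Q} (hm : Monotone f)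
    (hb : ∀ x y, y ≤ f x → ∃ x' ≤ x, f x' = y) : IsPMorphism f :=
  fun x y => ⟨hb x y, fun ⟨_, hx', h⟩ => h ▸ hm hx'⟩

/-- Points of `X` may be sent to the added top, so configurations that do not fit into `Q` can be
absorbed there. -/
theorem OmitsProhibited.of_map_withTop (h : OmitsProhibited (LowerSet (WithTop X)))
    {f : X → WithTop Q} (hf : IsPMorphism f) (hs : ∀ q : Q, ∃ x, f x = q) :
    OmitsProhibited (LowerSet (WithTop Q)) := by
  let g : WithTop X → WithTop Q := WithTop.recTopCoe ⊤ f
  have hg : IsPMorphism g := by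
    refine .of_monotone ?_ ?_
    · intro a b hab
      induction b using WithTop.recTopCoe with
      | top => exact le_top
      | coe b =>
        obtain ⟨a, rfl, hab'⟩ := WithTop.le_coe_iff.1 hab
        exact hf.monotone hab'
    · intro x y hy
      induction x using WithTop.recTopCoe with
      | top =>
        induction y using WithTop.recTopCoe with
        | top => exact ⟨⊤, le_rfl, rfl⟩
        | coe q =>
          obtain ⟨x, hx⟩ := hs q
          exact ⟨x, le_top, hx⟩
      | coe x =>
        obtain ⟨x', hx', rfl⟩ := (hf x y).1 hy
        exact ⟨x', WithTop.coe_le_coe.2 hx', rfl⟩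
  refine hg.omitsProhibited (fun y => ?_) h
  obtain ⟨x, -, hx⟩ := (hg ⊤ y).1 le_top
  exact ⟨x, hx⟩

theorem OmitsProhibited.of_map (h : OmitsProhibited (LowerSet (WithTop X)))
    {f : X → Q} (hf : IsPMorphism f) (hs : Function.Surjective f) :
    OmitsProhibited (LowerSet (WithTop Q)) := by
  refine h.of_map_withTop (f := fun x => (f x : WithTop Q)) (.of_monotone ?_ ?_) ?_
  · exact fun a b hab => WithTop.coe_le_coe.2 (hf.monotone hab)
  · intro x y hy
    obtain ⟨q, rfl, hq⟩ := WithTop.le_coe_iff.1 hy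
    obtain ⟨x', hx', rfl⟩ := (hf x q).1 hq
    exact ⟨x', hx', rfl⟩
  · intro q
    obtain ⟨x, rfl⟩ := hs q
    exact ⟨x, rfl⟩

/-- Unwanted points may be sent to the added bottom. The back condition is needed only for points of
`Q`, because the bottom of the source always maps to the bottom. -/
theorem OmitsProhibited.of_map_withBot (h : OmitsProhibited (LowerSet (WithBot (WithTop X))))
    {f : X → WithBot Q} (hm : Monotone f)
    (hb : ∀ x, ∀ q : Q, q ≤ f x → ∃ x' ≤ x, f x' = q) (hs : ∀ q : Q, ∃ x, f x = q) :
    OmitsProhibited (LowerSet (WithBot (WithTop Q))) := by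
  let k : WithBot Q → WithBot (WithTop Q) := WithBot.map WithTop.some
  have hk : ∀ {a b : WithBot Q}, k a ≤ k b ↔ a ≤ b := fun {a b} =>
    WithBot.map_le_iff _ (fun {_ _} => WithTop.coe_le_coe)
  let g : WithBot (WithTop X) → WithBot (WithTop Q) :=
    WithBot.recBotCoe ⊥ (WithTop.recTopCoe ((⊤ : WithTop Q) : WithBot (WithTop Q))
      (fun x => k (f x)))
  have hsurj : Function.Surjective g := by
    intro y
    induction y using WithBot.recBotCoe with
    | bot => exact ⟨⊥, rfl⟩
    | coe y =>
      induction y using WithTop.recTopCoe with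
      | top => exact ⟨((⊤ : WithTop X) : WithBot (WithTop X)), rfl⟩
      | coe q =>
        obtain ⟨x, hx⟩ := hs q
        exact ⟨((x : WithTop X) : WithBot (WithTop X)), congrArg k hx⟩
  have hg : IsPMorphism g := by
    refine .of_monotone ?_ ?_
    · intro a b hab
      induction a using WithBot.recBotCoe with
      | bot => exact bot_le
      | coe a =>
        obtain ⟨b, rfl, hab'⟩ := WithBot.coe_le_iff.1 hab
        induction b using WithTop.recTopCoe with
        | top => exact le_top (α := WithBot (WithTop Q))
        | coe b =>
          obtain ⟨a, rfl, hab''⟩ := WithTop.le_coe_iff.1 hab'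
          exact hk.2 (hm hab'')
    · intro x y hy
      by_cases hyb : y = ⊥
      · exact ⟨⊥, bot_le, hyb.symm⟩
      induction x using WithBot.recBotCoe with
      | bot => exact absurd (le_bot_iff.1 hy) hyb
      | coe x =>
        induction x using WithTop.recTopCoe with
        | top =>
          obtain ⟨x, hx⟩ := hsurj y
          exact ⟨x, le_top (α := WithBot (WithTop X)), hx⟩
        | coe x =>
          obtain ⟨y, rfl⟩ := WithBot.ne_bot_iff_exists.1 hyb
          change (y : WithBot (WithTop Q)) ≤ k (f x) at hy
          obtain ⟨q', hq'⟩ : ∃ q' : Q, f x = q' := by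
            cases hfx : f x with
            | bot => rw [hfx] at hy; exact absurd (le_bot_iff.1 hy) hyb
            | coe q' => exact ⟨q', rfl⟩
          rw [hq'] at hy
          obtain ⟨q, rfl, hq⟩ := WithTop.le_coe_iff.1 (WithBot.coe_le_coe.1 hy)
          obtain ⟨x', hx', hfx⟩ := hb x q (hq'.symm ▸ WithBot.coe_le_coe.2 hq)
          exact ⟨((x' : WithTop X) : WithBot (WithTop X)),
            WithBot.coe_le_coe.2 (WithTop.coe_le_coe.2 hx'), congrArg k hfx⟩
  exact hg.omitsProhibited hsurj h

/-- The principal lower set below `a` is obtained by adding a top element to `{x | x < a}`. -/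
def iioTop (a : X) : WithTop {x // x < a} → WithTop X := WithTop.recTopCoe a (fun x => x.1)

theorem isPMorphism_iioTop (a : X) : IsPMorphism (iioTop a) := by
  refine .of_monotone ?_ ?_
  · intro x y hxy
    induction y using WithTop.recTopCoe with
    | top =>
      induction x using WithTop.recTopCoe with
      | top => exact le_rfl
      | coe x => exact WithTop.coe_le_coe.2 x.2.le
    | coe y =>
      obtain ⟨x, rfl, hxy'⟩ := WithTop.le_coe_iff.1 hxy
      exact WithTop.coe_le_coe.2 hxy'
  · intro x y hy
    induction x using WithTop.recTopCoe with
    | top =>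
      obtain ⟨y, rfl, hy'⟩ := WithTop.le_coe_iff.1 hy
      rcases hy'.eq_or_lt with h | hlt
      · exact ⟨⊤, le_rfl, congrArg _ h.symm⟩
      · exact ⟨((⟨y, hlt⟩ : {x // x < a}) : WithTop _), le_top, rfl⟩
    | coe x =>
      obtain ⟨y, rfl, hy'⟩ := WithTop.le_coe_iff.1 hy
      exact ⟨((⟨y, lt_of_le_of_lt hy' x.2⟩ : {x // x < a}) : WithTop _),
        WithTop.coe_le_coe.2 (Subtype.coe_le_coe.1 hy'), rfl⟩

theorem iioTop_injective (a : X) : Function.Injective (iioTop a) := by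
  intro x y hxy
  induction x using WithTop.recTopCoe with
  | top =>
    induction y using WithTop.recTopCoe with
    | top => rfl
    | coe y => exact absurd (WithTop.coe_injective hxy).symm y.2.ne
  | coe x =>
    induction y using WithTop.recTopCoe with
    | top => exact absurd (WithTop.coe_injective hxy) x.2.ne
    | coe y => rw [Subtype.ext (WithTop.coe_injective hxy)]

theorem IsPMorphism.withBot_map {f : X → Q} (hf : IsPMorphism f) :
    IsPMorphism (WithBot.map f) := by
  refine .of_monotone (WithBot.monotone_map_iff.2 hf.monotone) ?_
  intro x y hy
  induction y using WithBot.recBotCoe with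
  | bot => exact ⟨⊥, bot_le, rfl⟩
  | coe y =>
    induction x using WithBot.recBotCoe with
    | bot => exact absurd (le_bot_iff.1 hy) (by simp)
    | coe x =>
      obtain ⟨x', hx', rfl⟩ := (hf x y).1 (WithBot.coe_le_coe.1 hy)
      exact ⟨x', WithBot.coe_le_coe.2 hx', rfl⟩

open Classical in
/-- The map that identifies all minimal elements with a new bottom element. -/
noncomputable def collapseMin (X : Type*) [PartialOrder X] :
    WithTop X → WithBot (WithTop {x : X // ¬ IsMin x}) :=
  WithTop.recTopCoe (((⊤ : WithTop {x : X // ¬ IsMin x})) : WithBot (WithTop {x : X // ¬ IsMin x}))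
    (fun x => if h : IsMin x then ⊥ else ((⟨x, h⟩ : {x : X // ¬ IsMin x}) : WithTop _))

theorem collapseMin_of_isMin {x : X} (h : IsMin x) : collapseMin X x = ⊥ := dif_pos h

theorem collapseMin_of_not_isMin {x : X} (h : ¬ IsMin x) :
    collapseMin X x = ((⟨x, h⟩ : {x : X // ¬ IsMin x}) : WithTop _) := dif_neg h

theorem exists_isMin_le [Finite X] (x : X) : ∃ m ≤ x, IsMin m := by
  obtain ⟨m, hm, hmin⟩ := Finite.exists_le_minimal (p := fun _ : X => True) (a := x) trivial
  exact ⟨m, hm, fun y hy => hmin.2 trivial hy⟩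

theorem collapseMin_surjective [Finite X] [Nonempty X] : Function.Surjective (collapseMin X) := by
  intro y
  induction y using WithBot.recBotCoe with
  | bot =>
    obtain ⟨m, -, hm⟩ := exists_isMin_le (Classical.arbitrary X)
    exact ⟨m, collapseMin_of_isMin hm⟩
  | coe y =>
    induction y using WithTop.recTopCoe with
    | top => exact ⟨⊤, rfl⟩
    | coe y => exact ⟨y.1, collapseMin_of_not_isMin y.2⟩

theorem isPMorphism_collapseMin [Finite X] [Nonempty X] : IsPMorphism (collapseMin X) := by
  refine .of_monotone ?_ ?_
  · intro a b hab
    induction b using WithTop.recTopCoe with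
    | top => exact le_top (α := WithBot (WithTop {x : X // ¬ IsMin x}))
    | coe b =>
      obtain ⟨a, rfl, hab'⟩ := WithTop.le_coe_iff.1 hab
      by_cases ha : IsMin a
      · rw [collapseMin_of_isMin ha]
        exact bot_le
      · have hb : ¬ IsMin b := fun hb => ha (hb.mono hab')
        rw [collapseMin_of_not_isMin ha, collapseMin_of_not_isMin hb]
        exact WithBot.coe_le_coe.2 (WithTop.coe_le_coe.2 hab')
  · intro x y hy
    induction x using WithTop.recTopCoe with
    | top =>
      obtain ⟨x, rfl⟩ := collapseMin_surjective y
      exact ⟨x, le_top, rfl⟩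
    | coe x =>
      by_cases hyb : y = ⊥
      · obtain ⟨m, hmx, hm⟩ := exists_isMin_le x
        exact ⟨m, WithTop.coe_le_coe.2 hmx, (collapseMin_of_isMin hm).trans hyb.symm⟩
      by_cases hx : IsMin x
      · rw [collapseMin_of_isMin hx] at hy
        exact absurd (le_bot_iff.1 hy) hyb
      · rw [collapseMin_of_not_isMin hx] at hy
        obtain ⟨y, rfl⟩ := WithBot.ne_bot_iff_exists.1 hyb
        obtain ⟨y, rfl, hy'⟩ := WithTop.le_coe_iff.1 (WithBot.coe_le_coe.1 hy)
        exact ⟨y.1, WithTop.coe_le_coe.2 hy', collapseMin_of_not_isMin y.2⟩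

theorem OmitsProhibited.withTop_Iio (h : OmitsProhibited (LowerSet (WithTop X))) (a : X) :
    OmitsProhibited (LowerSet (WithTop {x // x < a})) :=
  (isPMorphism_iioTop a).omitsProhibited_of_injective (iioTop_injective a) h

theorem OmitsProhibited.withBot_withTop_Iio
    (h : OmitsProhibited (LowerSet (WithBot (WithTop X)))) (a : X) :
    OmitsProhibited (LowerSet (WithBot (WithTop {x // x < a}))) :=
  (isPMorphism_iioTop a).withBot_map.omitsProhibited_of_injective
    (WithBot.map_injective (iioTop_injective a)) h

/-- Bridge between the two classifications: what lies above the minimal layer of a lowest summand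
obeys the restrictions on upper summands. -/
theorem OmitsProhibited.withBot_withTop_not_isMin [Finite X] [Nonempty X]
    (h : OmitsProhibited (LowerSet (WithTop X))) :
    OmitsProhibited (LowerSet (WithBot (WithTop {x : X // ¬ IsMin x}))) :=
  isPMorphism_collapseMin.omitsProhibited collapseMin_surjective h

end Transfer

/-! ### Maximal points when P₂ and P₄ are omitted -/

section TwoAdd

variable {P : Type*} [PartialOrder P]

/-- Sending all other points to the bottom is a p-morphism, because nothing lies strictly above a
maximal point; it produces P₄. -/
theorem OmitsProhibited.not_three_isMax (h : OmitsProhibited (LowerSet (WithBot (WithTop P))))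
    {a b c : P} (ha : IsMax a) (hb : IsMax b) (hc : IsMax c) (hab : a ≠ b) (hac : a ≠ c)
    (hbc : b ≠ c) : False := by
  classical
  let f : P → WithBot AntichainThree := fun x =>
    if x = a then AntichainThree.a else if x = b then AntichainThree.b
    else if x = c then AntichainThree.c else ⊥
  have hfa : f a = AntichainThree.a := if_pos rfl
  have hfb : f b = AntichainThree.b := (if_neg hab.symm).trans (if_pos rfl)
  have hfc : f c = AntichainThree.c :=
    (if_neg hac.symm).trans ((if_neg hbc.symm).trans (if_pos rfl))
  have hbot : ∀ x, (x = a ∨ x = b ∨ x = c) ∨ f x = ⊥ := by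
    intro x
    by_cases h1 : x = a
    · exact Or.inl (Or.inl h1)
    by_cases h2 : x = b
    · exact Or.inl (Or.inr (Or.inl h2))
    by_cases h3 : x = c
    · exact Or.inl (Or.inr (Or.inr h3))
    exact Or.inr (by simp [f, h1, h2, h3])
  refine not_omitsProhibited_two_add_three (h.of_map_withBot (f := f) ?_ ?_ ?_)
  · intro x y hxy
    rcases hbot x with (rfl | rfl | rfl) | hx
    · rw [ha.eq_of_le hxy]
    · rw [hb.eq_of_le hxy]
    · rw [hc.eq_of_le hxy]
    · rw [hx]
      exact bot_le
  · intro x q hq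
    obtain ⟨q', hq', hqq⟩ := WithBot.coe_le_iff.1 hq
    exact ⟨x, le_rfl, hq'.trans (congrArg _ (show q = q' from hqq).symm)⟩
  · intro q
    cases q
    exacts [⟨a, hfa⟩, ⟨b, hfb⟩, ⟨c, hfc⟩]

/-- The chain `z < a` and the point `b` are kept and all else goes to the bottom, which produces P₂.
Monotonicity uses that only `a` lies strictly above `z`. -/
theorem OmitsProhibited.not_chain_add_point
    (h : OmitsProhibited (LowerSet (WithBot (WithTop P))))
    {a b z : P} (ha : IsMax a) (hb : IsMax b) (hab : a ≠ b) (hza : z < a) (hzb : ¬ z ≤ b)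
    (hz : ∀ w, z < w → w = a) : False := by
  classical
  let f : P → WithBot PosetZ6 := fun x =>
    if x = a then PosetZ6.r else if x = b then PosetZ6.p
    else if x = z then PosetZ6.q else ⊥
  have hfa : f a = PosetZ6.r := if_pos rfl
  have hfb : f b = PosetZ6.p := (if_neg hab.symm).trans (if_pos rfl)
  have hfz : f z = PosetZ6.q :=
    (if_neg hza.ne).trans ((if_neg fun h => hzb h.le).trans (if_pos rfl))
  have hbot : ∀ x, (x = a ∨ x = b ∨ x = z) ∨ f x = ⊥ := by
    intro x
    by_cases h1 : x = a
    · exact Or.inl (Or.inl h1)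
    by_cases h2 : x = b
    · exact Or.inl (Or.inr (Or.inl h2))
    by_cases h3 : x = z
    · exact Or.inl (Or.inr (Or.inr h3))
    exact Or.inr (by simp [f, h1, h2, h3])
  refine not_omitsProhibited_two_add_Z6 (h.of_map_withBot (f := f) ?_ ?_ ?_)
  · intro x y hxy
    rcases hbot x with (rfl | rfl | rfl) | hx
    · rw [ha.eq_of_le hxy]
    · rw [hb.eq_of_le hxy]
    · rcases hxy.eq_or_lt with rfl | hlt
      · exact le_rfl
      · rw [hz y hlt, hfa, hfz]
        exact WithBot.coe_le_coe.2 (Or.inr ⟨rfl, rfl⟩)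
    · rw [hx]
      exact bot_le
  · intro x t ht
    rcases hbot x with (rfl | rfl | rfl) | hx
    · rw [hfa] at ht
      rcases WithBot.coe_le_coe.1 ht with rfl | ⟨rfl, -⟩
      exacts [⟨x, le_rfl, hfa⟩, ⟨z, hza.le, hfz⟩]
    · rw [hfb] at ht
      rcases WithBot.coe_le_coe.1 ht with rfl | ⟨-, h⟩
      exacts [⟨x, le_rfl, hfb⟩, nomatch h]
    · rw [hfz] at ht
      rcases WithBot.coe_le_coe.1 ht with rfl | ⟨-, h⟩
      exacts [⟨x, le_rfl, hfz⟩, nomatch h]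
    · rw [hx] at ht
      exact absurd (le_bot_iff.1 ht) (by simp)
  · intro t
    cases t
    exacts [⟨b, hfb⟩, ⟨z, hfz⟩, ⟨a, hfa⟩]

theorem exists_isMax_ge [Finite P] (x : P) : ∃ m, x ≤ m ∧ IsMax m := by
  obtain ⟨m, hm, hmax⟩ := Finite.exists_le_maximal (p := fun _ : P => True) (a := x) trivial
  exact ⟨m, hm, fun y hy => hmax.2 trivial hy⟩

/-- Take a maximal counterexample `z`. A maximal point above it is `a` or `b`, as there is no third
one. If it is `a`, then `z` is not below `b`; a point strictly above `z` other than `a` would be `b`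
or lie below `b`, so `a` is the only one and `not_chain_add_point` applies. The other case is
symmetric. -/
theorem OmitsProhibited.lt_of_isMax [Finite P]
    (h : OmitsProhibited (LowerSet (WithBot (WithTop P))))
    {a b : P} (ha : IsMax a) (hb : IsMax b) (hab : a ≠ b) (w : P) (hwa : w ≠ a) (hwb : w ≠ b) :
    w < a ∧ w < b := by
  by_contra hw
  obtain ⟨z, -, hz⟩ := Finite.exists_le_maximal
    (p := fun w => w ≠ a ∧ w ≠ b ∧ ¬ (w < a ∧ w < b)) (a := w) ⟨hwa, hwb, hw⟩
  obtain ⟨hza, hzb, hz'⟩ := hz.prop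
  have key : ∀ w, z < w → w = a ∨ w = b ∨ (w < a ∧ w < b) := by
    intro w hzw
    by_contra! hc
    exact hzw.not_ge (hz.2 ⟨hc.1, hc.2.1, fun h' => hc.2.2 h'.1 h'.2⟩ hzw.le)
  obtain ⟨m, hzm, hm⟩ := exists_isMax_ge z
  by_cases hma : m = a
  · subst hma
    have hzlt := lt_of_le_of_ne hzm hza
    have hnb : ¬ z ≤ b := fun h' => hz' ⟨hzlt, lt_of_le_of_ne h' hzb⟩
    refine h.not_chain_add_point ha hb hab hzlt hnb fun w hw => ?_
    rcases key w hw with h' | h' | h'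
    exacts [h', absurd (h' ▸ hw.le) hnb, absurd (hw.trans h'.2).le hnb]
  by_cases hmb : m = b
  · subst hmb
    have hzlt := lt_of_le_of_ne hzm hzb
    have hna : ¬ z ≤ a := fun h' => hz' ⟨lt_of_le_of_ne h' hza, hzlt⟩
    refine h.not_chain_add_point hb ha hab.symm hzlt hna fun w hw => ?_
    rcases key w hw with h' | h' | h'
    exacts [absurd (h' ▸ hw.le) hna, h', absurd (hw.trans h'.1).le hna]
  · exact h.not_three_isMax ha hb hm hab (Ne.symm hma) (Ne.symm hmb)

end TwoAdd

/-- If `2 + L + 2` omits the prohibited algebras, where `L` is the algebra of lower sets of the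
finite poset `P`, then every element of `P` is incomparable to at most one element. -/
theorem OmitsProhibited.eq_of_incompRel {P : Type u} [PartialOrder P] [Finite P]
    (h : OmitsProhibited (LowerSet (WithBot (WithTop P)))) {x y z : P}
    (hxy : IncompRel (· ≤ ·) x y) (hyz : IncompRel (· ≤ ·) y z) : x = z := by
  obtain ⟨n, hn⟩ : ∃ n, Nat.card P < n := ⟨_, Nat.lt_succ_self _⟩
  induction n generalizing P with
  | zero => exact absurd hn (Nat.not_lt_zero _)
  | succ n ih =>
    -- Points strictly below a common `a` live in a smaller poset, whose algebra gives a quotient of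
    -- the given one; the induction applies there.
    have hIio : ∀ a : P, x < a → y < a → z < a → x = z := by
      intro a hx hy hz
      have hcard : Nat.card {x : P // x < a} < Nat.card P :=
        Finite.card_subtype_lt (x := a) (lt_irrefl a)
      exact congrArg Subtype.val (ih (h.withBot_withTop_Iio a) (x := ⟨x, hx⟩) (y := ⟨y, hy⟩)
        (z := ⟨z, hz⟩) hxy hyz (hcard.trans_le (Nat.lt_succ_iff.1 hn)))
    obtain ⟨a, hya, ha⟩ := exists_isMax_ge y
    -- If `x` is not below `a`, choose a maximal `b` above `x`. By `lt_of_isMax` every other point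
    -- is below both, which forces `x = b` and `y = a`; then a further `z` lies below `y`.
    have key : ∀ x z : P, IncompRel (· ≤ ·) x y → IncompRel (· ≤ ·) y z → ¬ x ≤ a → x = z := by
      intro x z hxy hyz hxa
      by_contra hne
      obtain ⟨b, hxb, hb⟩ := exists_isMax_ge x
      have hab : a ≠ b := fun h' => hxa (h' ▸ hxb)
      have hxa' : x ≠ a := fun h' => hxa h'.le
      by_cases hxb' : x = b
      · subst hxb'
        have hyb : y ≠ x := fun h' => hxy.1 h'.ge
        by_cases hya' : y = a
        · subst hya'
          have hzy : z ≠ y := fun h' => hyz.1 h'.ge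
          exact hyz.2 (h.lt_of_isMax ha hb hab z hzy (Ne.symm hne)).1.le
        · exact hxy.2 (h.lt_of_isMax ha hb hab y hya' hyb).2.le
      · exact hxa (h.lt_of_isMax ha hb hab x hxa' hxb').1.le
    by_cases hxa : x ≤ a
    · by_cases hza : z ≤ a
      · have hya' : y ≠ a := fun h' => hxy.1 (h'.symm ▸ hxa)
        exact hIio a (lt_of_le_of_ne hxa fun h' => hxy.2 (h'.symm ▸ hya))
          (lt_of_le_of_ne hya hya') (lt_of_le_of_ne hza fun h' => hyz.1 (h'.symm ▸ hya))
      · exact (key z x hyz.symm hxy.symm hza).symm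
    · exact key x z hxy hyz hxa

/-- A poset is ordinally indecomposable if it is not the ordinal sum of two nonempty posets. -/
def OrdinallyIndecomposable (X : Type*) [PartialOrder X] : Prop :=
  ∀ V : LowerSet X, (∃ x, x ∈ V) → (∀ x ∈ V, ∀ y ∉ V, x ≤ y) → ∀ x, x ∈ V

/-! ### Indecomposable posets for upper summands -/

section Classification

variable {X : Type u} [PartialOrder X]

theorem nonempty_orderIso_unit {a : X} (ha : ∀ x, x = a) : Nonempty (X ≃o Unit) :=
  ⟨orderIsoOfSurjective (fun _ => ()) (fun x y => by simp [ha x, ha y]) fun _ => ⟨a, rfl⟩⟩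

theorem nonempty_orderIso_antichainTwo {a b : X} (hab : IncompRel (· ≤ ·) a b)
    (h : ∀ x, x = a ∨ x = b) : Nonempty (X ≃o AntichainTwo) := by
  refine ⟨(orderIsoOfSurjective (fun x => AntichainTwo.casesOn x a b) ?_ ?_).symm⟩
  · intro x y
    cases x <;> cases y
    exacts [iff_of_true le_rfl le_rfl, iff_of_false hab.1 (fun h => nomatch h),
      iff_of_false hab.2 (fun h => nomatch h), iff_of_true le_rfl le_rfl]
  · intro x
    rcases h x with rfl | rfl
    exacts [⟨.a, rfl⟩, ⟨.b, rfl⟩]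

/-- The finite ordinally indecomposable posets with algebra `L` of lower sets such that `2 + L + 2`
omits the prohibited algebras. -/
theorem OmitsProhibited.classify_two_add [Finite X] [Nonempty X]
    (h : OmitsProhibited (LowerSet (WithBot (WithTop X)))) (hX : OrdinallyIndecomposable X) :
    Nonempty (X ≃o Unit) ∨ Nonempty (X ≃o AntichainTwo) := by
  obtain ⟨m, -, hm⟩ := exists_isMin_le (Classical.arbitrary X)
  -- The set of `m` and the points incomparable to it is an initial ordinal summand: any other point
  -- is above `m` by minimality, and it cannot be a second point incomparable to some `x` of the
  -- set. Indecomposability makes this set everything.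
  have key : ∀ x, x = m ∨ IncompRel (· ≤ ·) m x := by
    have hlt : ∀ y, ¬ (y = m ∨ IncompRel (· ≤ ·) m y) → m < y := by
      intro y hy
      by_contra hmy
      refine hy ?_
      by_cases hym : y = m
      · exact Or.inl hym
      · exact Or.inr ⟨fun h' => hmy (lt_of_le_of_ne h' (Ne.symm hym)),
          fun h' => hym (hm.eq_of_le h')⟩
    refine hX ⟨{x | x = m ∨ IncompRel (· ≤ ·) m x}, ?_⟩ ⟨m, Or.inl rfl⟩ ?_
    · rintro x y hyx hx
      by_contra hy
      have hmx := (hlt y hy).trans_le hyx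
      rcases hx with rfl | hx
      · exact lt_irrefl _ hmx
      · exact hx.1 hmx.le
    · rintro x hx y hy
      have hmy := hlt y hy
      rcases hx with rfl | hx
      · exact hmy.le
      by_contra hxy
      by_cases hyx : y ≤ x
      · exact hx.1 (hmy.le.trans hyx)
      · have := h.eq_of_incompRel hx ⟨hxy, hyx⟩
        exact hmy.ne this
  by_cases hex : ∃ x, x ≠ m
  · obtain ⟨x, hx⟩ := hex
    have hmx := (key x).resolve_left hx
    refine Or.inr (nonempty_orderIso_antichainTwo hmx fun y => ?_)
    rcases key y with rfl | hy
    · exact Or.inl rfl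
    · exact Or.inr (h.eq_of_incompRel hy.symm hmx)
  · push Not at hex
    exact Or.inl (nonempty_orderIso_unit hex)

/-- Between antichains every map is a p-morphism, so all points other than `a` and `b` can be
merged, which produces P₃. -/
theorem OmitsProhibited.not_three_of_antichain (h : OmitsProhibited (LowerSet (WithTop X)))
    (hX : ∀ x : X, IsMin x) {a b c : X} (hab : a ≠ b) (hac : a ≠ c) (hbc : b ≠ c) : False := by
  classical
  let f : X → AntichainThree := fun x => if x = a then .a else if x = b then .b else .c
  refine not_omitsProhibited_three (h.of_map (f := f) (.of_monotone ?_ ?_) ?_)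
  · intro x y hxy
    rw [(hX y).eq_of_le hxy]
  · intro x y hy
    exact ⟨x, le_rfl, (show y = f x from hy).symm⟩
  · intro q
    cases q
    exacts [⟨a, if_pos rfl⟩, ⟨b, (if_neg hab.symm).trans (if_pos rfl)⟩,
      ⟨c, (if_neg hac.symm).trans (if_neg hbc.symm)⟩]

end Classification

/-! ### Indecomposable posets for the lowest summand -/

section ClassifyAddTwo

variable {X : Type u} [PartialOrder X]

/-- `x` is minimal among the elements that are not minimal. -/
def IsSecondLayer (x : X) : Prop := ¬ IsMin x ∧ ∀ y < x, IsMin y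

theorem exists_isSecondLayer_le [Finite X] {x : X} (hx : ¬ IsMin x) :
    ∃ z ≤ x, IsSecondLayer z := by
  obtain ⟨z, hz, hmin⟩ := Finite.exists_le_minimal (p := fun x : X => ¬ IsMin x) (a := x) hx
  refine ⟨z, hz, hmin.prop, fun y hy => ?_⟩
  by_contra hy'
  exact hy.not_ge (hmin.2 hy' hy.le)

/-- Some second-layer `z'` lies below `w`. If `z` differed from `z'` and were not below `w`, then
among the non-minimal points `z` would be incomparable to both `z'` and `w`, contrary to
`eq_of_incompRel`. -/
theorem OmitsProhibited.lt_of_isSecondLayer [Finite X] [Nonempty X]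
    (h : OmitsProhibited (LowerSet (WithTop X))) {z w : X} (hz : IsSecondLayer z)
    (hw : ¬ IsMin w) (hw' : ¬ IsSecondLayer w) : z < w := by
  obtain ⟨z', hz'w, hz'⟩ := exists_isSecondLayer_le hw
  have hne : ∀ z, IsSecondLayer z → z ≠ w := fun z hz h' => hw' (h' ▸ hz)
  by_cases hzz : z = z'
  · subst hzz
    exact lt_of_le_of_ne hz'w (hne z hz)
  have hinc : IncompRel (· ≤ ·) z z' :=
    ⟨fun h' => hz.1 (hz'.2 z (lt_of_le_of_ne h' hzz)),
      fun h' => hz'.1 (hz.2 z' (lt_of_le_of_ne h' (Ne.symm hzz)))⟩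
  by_cases hzw : z ≤ w
  · exact lt_of_le_of_ne hzw (hne z hz)
  by_cases hwz : w ≤ z
  · exact absurd (hz.2 w (lt_of_le_of_ne hwz (hne z hz).symm)) hw
  have := h.withBot_withTop_not_isMin.eq_of_incompRel (x := ⟨w, hw⟩) (y := ⟨z, hz.1⟩)
    (z := ⟨z', hz'.1⟩) ⟨hwz, hzw⟩ hinc
  exact absurd (congrArg Subtype.val this).symm (hne z' hz')

/-- Every minimal element lies below an element of the second layer. -/
theorem OmitsProhibited.exists_isSecondLayer_ge [Finite X] [Nonempty X]
    (h : OmitsProhibited (LowerSet (WithTop X))) {t w : X} (ht : IsMin t) (hw : ¬ IsMin w) :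
    ∃ z, IsSecondLayer z ∧ t ≤ z := by
  classical
  by_contra hS
  let S : X → Prop := fun m => ∃ z, IsSecondLayer z ∧ m ≤ z
  let T : X → Prop := fun x => ∃ t ≤ x, IsMin t ∧ ¬ S t
  -- Minimal points go to `q` or `p` according to whether the second layer covers them. Non-minimal
  -- points go to `⊤` if they lie above an uncovered minimal point and to `r` otherwise. An
  -- uncovered `t` makes this map onto, which produces P₁.
  let f : X → WithTop PosetZ6 := fun x =>
    if IsMin x then (if S x then PosetZ6.q else PosetZ6.p) else if T x then ⊤ else PosetZ6.r
  have hq : ∀ x, IsMin x → S x → f x = PosetZ6.q := fun x h1 h2 => by simp [f, h1, h2]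
  have hp : ∀ x, IsMin x → ¬ S x → f x = PosetZ6.p := fun x h1 h2 => by simp [f, h1, h2]
  have htop : ∀ x, ¬ IsMin x → T x → f x = ⊤ := fun x h1 h2 => by simp [f, h1, h2]
  have hr : ∀ x, ¬ IsMin x → ¬ T x → f x = PosetZ6.r := fun x h1 h2 => by simp [f, h1, h2]
  have hqle : ∀ x, ¬ IsMin x → ∃ x' ≤ x, f x' = PosetZ6.q := by
    intro x hx
    obtain ⟨z, hzx, hz⟩ := exists_isSecondLayer_le hx
    obtain ⟨m, hmz, hm⟩ := exists_isMin_le z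
    exact ⟨m, hmz.trans hzx, hq m hm ⟨z, hz, hmz⟩⟩
  have hrle : ∀ x, ¬ IsMin x → ∃ x' ≤ x, f x' = PosetZ6.r := by
    intro x hx
    obtain ⟨z, hzx, hz⟩ := exists_isSecondLayer_le hx
    exact ⟨z, hzx, hr z hz.1 fun ⟨t, htz, _, htS⟩ => htS ⟨z, hz, htz⟩⟩
  refine not_omitsProhibited_Z6 (h.of_map_withTop (f := f) (.of_monotone ?_ ?_) ?_)
  · intro y x hyx
    by_cases hx : IsMin x
    · rw [hx.eq_of_le hyx]
    by_cases hT : T x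
    · rw [htop x hx hT]
      exact le_top
    rw [hr x hx hT]
    by_cases hy : IsMin y
    · have hSy : S y := by_contra fun hSy => hT ⟨y, hyx, hy, hSy⟩
      rw [hq y hy hSy]
      exact WithTop.coe_le_coe.2 (Or.inr ⟨rfl, rfl⟩)
    · rw [hr y hy fun ⟨t, hty, ht⟩ => hT ⟨t, hty.trans hyx, ht⟩]
  · intro x y hy
    by_cases hx : IsMin x
    · by_cases hSx : S x
      · rw [hq x hx hSx] at hy
        obtain ⟨y, rfl, rfl | ⟨-, h'⟩⟩ := WithTop.le_coe_iff.1 hy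
        exacts [⟨x, le_rfl, hq x hx hSx⟩, nomatch h']
      · rw [hp x hx hSx] at hy
        obtain ⟨y, rfl, rfl | ⟨-, h'⟩⟩ := WithTop.le_coe_iff.1 hy
        exacts [⟨x, le_rfl, hp x hx hSx⟩, nomatch h']
    by_cases hT : T x
    · induction y using WithTop.recTopCoe with
      | top => exact ⟨x, le_rfl, htop x hx hT⟩
      | coe y =>
        cases y
        · obtain ⟨t, htx, ht, htS⟩ := hT
          exact ⟨t, htx, hp t ht htS⟩
        · exact hqle x hx
        · exact hrle x hx
    · rw [hr x hx hT] at hy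
      obtain ⟨y, rfl, rfl | ⟨rfl, -⟩⟩ := WithTop.le_coe_iff.1 hy
      exacts [⟨x, le_rfl, hr x hx hT⟩, hqle x hx]
  · intro y
    cases y
    · exact ⟨t, hp t ht hS⟩
    · obtain ⟨x, -, hx⟩ := hqle w hw
      exact ⟨x, hx⟩
    · obtain ⟨x, -, hx⟩ := hrle w hw
      exact ⟨x, hx⟩

/-- If there are just two elements `a`, `b` that are not minimal, then one of them lies above all
minimal elements. -/
theorem OmitsProhibited.le_or_le_of_two (h : OmitsProhibited (LowerSet (WithTop X))) {a b t t' : X}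
    (ha : ¬ IsMin a) (hb : ¬ IsMin b) (hab : a ≠ b) (hX : ∀ x, IsMin x ∨ x = a ∨ x = b)
    (hcov : ∀ x, IsMin x → x ≤ a ∨ x ≤ b) (hnab : ¬ a ≤ b) (hnba : ¬ b ≤ a)
    (ht : IsMin t) (ht' : IsMin t') (hta : ¬ t ≤ a) (htb : ¬ t' ≤ b) : False := by
  classical
  have hlea : ∀ x, x ≤ a → x = a ∨ IsMin x := by
    intro x hx
    rcases hX x with h' | h' | h'
    exacts [Or.inr h', Or.inl h', absurd (h' ▸ hx) hnba]
  have hleb : ∀ x, x ≤ b → x = b ∨ IsMin x := by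
    intro x hx
    rcases hX x with h' | h' | h'
    exacts [Or.inr h', absurd (h' ▸ hx) hnab, Or.inl h']
  have hma : ∀ {x}, IsMin x → x ≠ a := fun hx h' => ha (h' ▸ hx)
  have hmb : ∀ {x}, IsMin x → x ≠ b := fun hx h' => hb (h' ▸ hx)
  have htb' := (hcov t ht).resolve_left hta
  have hta' := (hcov t' ht').resolve_right htb
  -- With a common lower bound the poset maps onto `PosetD`, minimal points being sorted by which of
  -- `a`, `b` they lie below; this produces P₅.
  by_cases hc : ∃ c, IsMin c ∧ c ≤ a ∧ c ≤ b
  · obtain ⟨c, hcm, hca, hcb⟩ := hc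
    let f : X → PosetD := fun x => if x = a then .x else if x = b then .y else
      if x ≤ a then (if x ≤ b then .c else .l) else .r
    have hfa : f a = .x := if_pos rfl
    have hfb : f b = .y := (if_neg hab.symm).trans (if_pos rfl)
    have hfc : ∀ x, IsMin x → x ≤ a → x ≤ b → f x = .c := fun x hx h1 h2 => by
      simp [f, hma hx, hmb hx, h1, h2]
    have hfl : ∀ x, IsMin x → ¬ x ≤ b → f x = .l := fun x hx h2 => by
      simp [f, hma hx, hmb hx, h2, (hcov x hx).resolve_right h2]
    have hfr : ∀ x, IsMin x → ¬ x ≤ a → f x = .r := fun x hx h1 => by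
      simp [f, hma hx, hmb hx, h1]
    have hcases : ∀ x, IsMin x → f x = .c ∨ f x = .l ∨ f x = .r := by
      intro x hx
      by_cases h1 : x ≤ a
      · by_cases h2 : x ≤ b
        · exact Or.inl (hfc x hx h1 h2)
        · exact Or.inr (Or.inl (hfl x hx h2))
      · exact Or.inr (Or.inr (hfr x hx h1))
    refine not_omitsProhibited_D (h.of_map (f := f) (.of_monotone ?_ ?_) ?_)
    · intro y x hyx
      rcases hX x with hx | rfl | rfl
      · rw [hx.eq_of_le hyx]
      · rcases hlea y hyx with rfl | hy
        · exact le_rfl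
        rw [hfa]
        by_cases h2 : y ≤ b
        · rw [hfc y hy hyx h2]
          exact Or.inr (Or.inr (Or.inl ⟨rfl, rfl⟩))
        · rw [hfl y hy h2]
          exact Or.inr (Or.inl ⟨rfl, rfl⟩)
      · rcases hleb y hyx with rfl | hy
        · exact le_rfl
        rw [hfb]
        by_cases h1 : y ≤ a
        · rw [hfc y hy h1 hyx]
          exact Or.inr (Or.inr (Or.inr (Or.inl ⟨rfl, rfl⟩)))
        · rw [hfr y hy h1]
          exact Or.inr (Or.inr (Or.inr (Or.inr ⟨rfl, rfl⟩)))
    · intro z d hd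
      have hyy : d = f z ∨ (d = .l ∧ f z = .x) ∨ (d = .c ∧ f z = .x) ∨ (d = .c ∧ f z = .y) ∨
        (d = .r ∧ f z = .y) := hd
      rcases hX z with hx | rfl | rfl
      · refine ⟨z, le_rfl, ?_⟩
        rcases hyy with h' | h' | h' | h' | h'
        · exact h'.symm
        all_goals rcases hcases z hx with h'' | h'' | h'' <;> simp [h''] at h'
      · simp only [hfa, reduceCtorEq, and_false, or_false, and_true] at hyy
        rcases hyy with rfl | rfl | rfl
        exacts [⟨z, le_rfl, hfa⟩, ⟨t', hta', hfl t' ht' htb⟩, ⟨c, hca, hfc c hcm hca hcb⟩]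
      · simp only [hfb, reduceCtorEq, and_false, false_or, and_true] at hyy
        rcases hyy with rfl | rfl | rfl
        exacts [⟨z, le_rfl, hfb⟩, ⟨c, hcb, hfc c hcm hca hcb⟩, ⟨t, htb', hfr t ht hta⟩]
    · intro d
      cases d
      exacts [⟨t', hfl t' ht' htb⟩, ⟨c, hfc c hcm hca hcb⟩, ⟨t, hfr t ht hta⟩, ⟨a, hfa⟩, ⟨b, hfb⟩]
  -- Without a common lower bound, `b` and all points below it can be collapsed to the isolated
  -- point `p`, while `t' < a` becomes the chain; this produces P₁.
  · let f : X → PosetZ6 := fun x => if x = a then .r else if x ≤ a then .q else .p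
    have hfa : f a = .r := if_pos rfl
    have hfp : ∀ x, ¬ x ≤ a → f x = .p := fun x h1 =>
      (if_neg fun h' => h1 h'.le).trans (if_neg h1)
    have hfq : ∀ x, IsMin x → x ≤ a → f x = .q := fun x hx h1 => by simp [f, h1, hma hx]
    have hnot : ∀ x, x ≤ b → ¬ x ≤ a := by
      intro x hxb hxa
      rcases hleb x hxb with rfl | hx
      exacts [hnba hxa, hc ⟨x, hx, hxa, hxb⟩]
    have ht'q := hfq t' ht' hta'
    refine not_omitsProhibited_Z6
      ((h.of_map (f := f) (.of_monotone ?_ ?_) ?_))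
    · intro y x hyx
      rcases hX x with hx | rfl | rfl
      · rw [hx.eq_of_le hyx]
      · rcases hlea y hyx with rfl | hy
        · exact le_rfl
        rw [hfa, hfq y hy hyx]
        exact Or.inr ⟨rfl, rfl⟩
      · rw [hfp y (hnot y hyx), hfp x (hnot x le_rfl)]
    · intro x y hy
      have hyy : y = f x ∨ (y = .q ∧ f x = .r) := hy
      rcases hyy with h' | ⟨rfl, hx⟩
      · exact ⟨x, le_rfl, h'.symm⟩
      · have hxa : x = a := by
          by_contra hxa
          by_cases hle : x ≤ a
          · simp [f, hxa, hle] at hx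
          · simp [f, hxa, hle] at hx
        exact ⟨t', hxa ▸ hta', ht'q⟩
    · intro y
      cases y
      exacts [⟨t, hfp t hta⟩, ⟨t', ht'q⟩, ⟨a, hfa⟩]

theorem nonempty_orderIso_posetZ8 {a b t u : X} (ha : ¬ IsMin a) (hb : ¬ IsMin b)
    (hab : a ≠ b) (ht : IsMin t) (hu : IsMin u) (hta : ¬ t ≤ a) (htb : t ≤ b) (hua : u ≤ a)
    (hub : u ≤ b) (hnab : ¬ a ≤ b) (hnba : ¬ b ≤ a)
    (hX : ∀ x, x = t ∨ x = u ∨ x = a ∨ x = b) : Nonempty (X ≃o PosetZ8) := by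
  have hma : ∀ {x y : X}, IsMin x → ¬ IsMin y → ¬ y ≤ x := fun hx hy h' => hy (hx.mono h')
  have htu : t ≠ u := fun h' => hta (h' ▸ hua)
  have htu' : ¬ t ≤ u := fun h' => htu (hu.eq_of_le h')
  have hut' : ¬ u ≤ t := fun h' => htu (ht.eq_of_le h').symm
  refine ⟨(orderIsoOfSurjective (fun x => PosetZ8.casesOn x t u a b) ?_ ?_).symm⟩
  · intro x y
    rw [PosetZ8.le_iff]
    cases x <;> cases y <;>
      simp [hta, htb, hua, hub, hnab, hnba, htu', hut', hma ht ha, hma ht hb, hma hu ha, hma hu hb]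
  · intro x
    rcases hX x with rfl | rfl | rfl | rfl
    exacts [⟨.p, rfl⟩, ⟨.q, rfl⟩, ⟨.r, rfl⟩, ⟨.s, rfl⟩]

/-- The finite ordinally indecomposable posets with algebra `L` of lower sets such that `L + 2`
omits the prohibited algebras. -/
theorem OmitsProhibited.classify_add_two [Finite X] [Nonempty X]
    (h : OmitsProhibited (LowerSet (WithTop X))) (hX : OrdinallyIndecomposable X) :
    Nonempty (X ≃o Unit) ∨ Nonempty (X ≃o AntichainTwo) ∨ Nonempty (X ≃o PosetZ8) := by
  by_cases hmin : ∀ x : X, IsMin x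
  · obtain ⟨a⟩ := ‹Nonempty X›
    by_cases hex : ∃ b, b ≠ a
    · obtain ⟨b, hb⟩ := hex
      have hab : IncompRel (· ≤ ·) a b :=
        ⟨fun h' => hb ((hmin b).eq_of_le h').symm, fun h' => hb ((hmin a).eq_of_le h')⟩
      refine Or.inr (Or.inl (nonempty_orderIso_antichainTwo hab fun x => ?_))
      by_contra! hx
      exact h.not_three_of_antichain hmin hb.symm hx.1.symm hx.2.symm
    · push Not at hex
      exact Or.inl (nonempty_orderIso_unit hex)
  push Not at hmin
  obtain ⟨w, hw⟩ := hmin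
  have hcov : ∀ t : X, IsMin t → ∃ z, IsSecondLayer z ∧ t ≤ z :=
    fun t ht => h.exists_isSecondLayer_ge ht hw
  -- The two lowest layers form an initial ordinal summand: a higher point is above the whole second
  -- layer, and hence above every minimal point by `hcov`.
  have hlayer : ∀ x : X, IsMin x ∨ IsSecondLayer x := by
    refine hX ⟨{x | IsMin x ∨ IsSecondLayer x}, ?_⟩ ?_ ?_
    · rintro x y hyx (hx | hx)
      · exact Or.inl (hx.mono hyx)
      · rcases hyx.eq_or_lt with rfl | hlt
        exacts [Or.inr hx, Or.inl (hx.2 y hlt)]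
    · obtain ⟨m, -, hm⟩ := exists_isMin_le w
      exact ⟨m, Or.inl hm⟩
    · rintro x hx y hy
      have hy1 : ¬ IsMin y := fun h' => hy (Or.inl h')
      have hy2 : ¬ IsSecondLayer y := fun h' => hy (Or.inr h')
      rcases hx with hx | hx
      · obtain ⟨z, hz, hxz⟩ := hcov x hx
        exact hxz.trans (h.lt_of_isSecondLayer hz hy1 hy2).le
      · exact (h.lt_of_isSecondLayer hx hy1 hy2).le
  have hinc : ∀ {a b : X}, ¬ IsMin a → ¬ IsMin b → a ≠ b → ¬ a ≤ b := by
    intro a b ha hb hab hle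
    exact ha (((hlayer b).resolve_left hb).2 a (lt_of_le_of_ne hle hab))
  -- Otherwise the minimal layer alone would split off as an ordinal summand.
  have hnode : ¬ ∀ m x : X, IsMin m → ¬ IsMin x → m ≤ x := by
    intro hle
    refine hw (hX ⟨{x | IsMin x}, fun x y hyx hx => hx.mono hyx⟩ ?_
      (fun x hx y hy => hle x y hx hy) w)
    obtain ⟨m, -, hm⟩ := exists_isMin_le w
    exact ⟨m, hm⟩
  push Not at hnode
  obtain ⟨t, a, ht, ha, hta⟩ := hnode
  obtain ⟨b, hb, htb⟩ := hcov t ht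
  replace hb := hb.1
  have hab : a ≠ b := fun h' => hta (h' ▸ htb)
  -- Distinct points of the second layer are incomparable, so a third one contradicts
  -- `eq_of_incompRel` above the minimal layer.
  have hab' : ∀ x : X, IsMin x ∨ x = a ∨ x = b := by
    intro x
    by_contra! hx
    have := h.withBot_withTop_not_isMin.eq_of_incompRel (x := ⟨a, ha⟩) (y := ⟨b, hb⟩)
      (z := ⟨x, hx.1⟩) ⟨hinc ha hb hab, hinc hb ha hab.symm⟩
      ⟨hinc hb hx.1 hx.2.2.symm, hinc hx.1 hb hx.2.2⟩
    exact hx.2.1 (congrArg Subtype.val this).symm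
  have hall : ∀ m, IsMin m → m ≤ b := by
    intro t' ht'
    by_contra htb'
    refine h.le_or_le_of_two ha hb hab hab' ?_ (hinc ha hb hab) (hinc hb ha hab.symm) ht ht' hta htb'
    intro x hx
    obtain ⟨z, hz, hxz⟩ := hcov x hx
    rcases hab' z with h' | rfl | rfl
    exacts [absurd h' hz.1, Or.inl hxz, Or.inr hxz]
  obtain ⟨u, hua, hu⟩ := exists_isMin_le a
  have htu : t ≠ u := fun h' => hta (h' ▸ hua)
  have hlt : ∀ m, IsMin m → m < b := fun m hm => lt_of_le_of_ne (hall m hm) fun h' => hb (h' ▸ hm)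
  refine Or.inr (Or.inr (nonempty_orderIso_posetZ8 ha hb hab ht hu hta htb hua (hall u hu)
    (hinc ha hb hab) (hinc hb ha hab.symm) fun x => ?_))
  by_contra! hx
  have hxm : IsMin x := (hab' x).resolve_right fun h' => h'.elim hx.2.2.1 hx.2.2.2
  -- All minimal points lie below `b`; a third one would give an antichain of at least three points
  -- strictly below `b`.
  refine (h.withTop_Iio b).not_three_of_antichain (a := ⟨t, hlt t ht⟩) (b := ⟨u, hlt u hu⟩)
    (c := ⟨x, hlt x hxm⟩) ?_ (fun h' => htu (congrArg Subtype.val h'))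
    (fun h' => hx.1 (congrArg Subtype.val h').symm) (fun h' => hx.2.1 (congrArg Subtype.val h').symm)
  rintro ⟨y, hy⟩ ⟨z, hz⟩ hzy
  have hym : IsMin y := ((hlayer b).resolve_left hb).2 y hy
  exact hym hzy

end ClassifyAddTwo

/-! ### Nodes -/

section Nodeless

variable {B : Type u} [HeytingAlgebra B] [Finite B]

open Classical in
/-- A finite nodeless algebra is the algebra of lower sets of a finite ordinally indecomposable
poset. -/
theorem IsNodeless.exists_orderIso_lowerSet (hB : IsNodeless B) :
    ∃ (X : Type u) (_ : PartialOrder X), Finite X ∧ Nonempty X ∧ OrdinallyIndecomposable X ∧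
      Nonempty (B ≃o LowerSet X) := by
  have := Fintype.ofFinite B
  let X := {a : B // SupIrred a}
  let e : B ≃o LowerSet X := OrderIso.lowerSetSupIrred
  refine ⟨X, inferInstance, inferInstance, ?_, ?_, ⟨e⟩⟩
  · by_contra hX
    rw [not_nonempty_iff] at hX
    obtain ⟨a, b, hab⟩ := hB.1
    exact hab (e.injective (LowerSet.ext (Subsingleton.elim _ _)))
  · rintro V ⟨x, hx⟩ hV y
    -- An initial ordinal summand `V` is comparable with every lower set: one that is not contained
    -- in `V` has a point outside `V`, which lies above all of `V`.
    have hnode : IsNode (e.symm V) := by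
      intro b
      rw [e.symm_apply_le, e.le_symm_apply]
      by_cases hle : e b ≤ V
      · exact Or.inr hle
      · obtain ⟨z, hzb, hzV⟩ := Set.not_subset.1 hle
        exact Or.inl fun w hw => (e b).lower (hV w hw z hzV) hzb
    rcases hB.2 _ hnode with h | h
    · rw [e.symm_apply_eq, map_bot] at h
      rw [h] at hx
      exact hx.elim
    · rw [e.symm_apply_eq, map_top] at h
      rw [h]
      trivial

theorem IsNodeless.classify_add_two (hB : IsNodeless B) (h : OmitsProhibited (OrdSum B Bool)) :
    Nonempty (B ≃o Bool) ∨ Nonempty (B ≃o Bool × Bool) ∨ Nonempty (B ≃o LowerSet PosetZ8) := by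
  obtain ⟨X, _, _, _, hX, ⟨e⟩⟩ := hB.exists_orderIso_lowerSet
  have h' : OmitsProhibited (LowerSet (WithTop X)) :=
    h.of_orderIso ((lowerSetWithTop X).trans (OrdSum.congr e.symm (OrderIso.refl Bool)))
  rcases h'.classify_add_two hX with ⟨⟨k⟩⟩ | ⟨⟨k⟩⟩ | ⟨⟨k⟩⟩
  · exact Or.inl ⟨(e.trans (LowerSet.map k)).trans lowerSetUnit⟩
  · exact Or.inr (Or.inl ⟨(e.trans (LowerSet.map k)).trans lowerSetAntichainTwo⟩)
  · exact Or.inr (Or.inr ⟨e.trans (LowerSet.map k)⟩)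

theorem IsNodeless.classify_two_add (hB : IsNodeless B)
    (h : OmitsProhibited (OrdSum Bool (OrdSum B Bool))) :
    Nonempty (B ≃o Bool) ∨ Nonempty (B ≃o Bool × Bool) := by
  obtain ⟨X, _, _, _, hX, ⟨e⟩⟩ := hB.exists_orderIso_lowerSet
  have h' : OmitsProhibited (LowerSet (WithBot (WithTop X))) :=
    h.of_orderIso ((lowerSetWithBot _).trans (OrdSum.congr (OrderIso.refl Bool)
      ((lowerSetWithTop X).trans (OrdSum.congr e.symm (OrderIso.refl Bool)))))
  rcases h'.classify_two_add hX with ⟨⟨k⟩⟩ | ⟨⟨k⟩⟩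
  · exact Or.inl ⟨(e.trans (LowerSet.map k)).trans lowerSetUnit⟩
  · exact Or.inr ⟨(e.trans (LowerSet.map k)).trans lowerSetAntichainTwo⟩

end Nodeless

/-! ### Inheritance of omission by the summands -/

section Summands

variable {A B : Type*} [HeytingAlgebra A] [HeytingAlgebra B]

theorem OmitsProhibited.left_add_two (h : OmitsProhibited (OrdSum (OrdSum A B) Bool)) :
    OmitsProhibited (OrdSum A Bool) := by
  refine h.addTwo_of_partial
    (OrdSum.isPartialHeytingHom_inl.comp OrdSum.isPartialHeytingHom_inl OrdSum.inl_injective)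
    (OrdSum.inl_injective.comp OrdSum.inl_injective) fun h' => ?_
  have : (⊥ : Bool) = ⊤ := congrArg (fun x : OrdSum (OrdSum A B) Bool => x.1.2) h'
  exact absurd this (by decide)

/-- As `A` is nontrivial, the gluing point is nonzero. It is also dense, so the part above it
together with `⊥` is a subalgebra. -/
theorem OmitsProhibited.two_add_right_add_two [Nontrivial A]
    (h : OmitsProhibited (OrdSum (OrdSum A B) Bool)) :
    OmitsProhibited (OrdSum Bool (OrdSum B Bool)) := by
  have h' : OmitsProhibited (OrdSum A (OrdSum B Bool)) := h.of_orderIso OrdSum.assoc.symm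
  refine h'.twoAdd_of_brouwerian OrdSum.isBrouwerianHom_inr OrdSum.inr_injective ?_ ?_
  · intro h''
    have : (⊤ : A) = ⊥ := congrArg (fun x : OrdSum A (OrdSum B Bool) => x.1.1) h''
    exact top_ne_bot this
  · exact (himp_bot _).symm.trans (OrdSum.inr_himp_inl _ bot_ne_top)

theorem OrdSum.finite_left [Finite (OrdSum A B)] : Finite A :=
  Finite.of_injective _ (inl_injective (B := B))

theorem OrdSum.finite_right [Finite (OrdSum A B)] : Finite B :=
  Finite.of_injective _ (inr_injective (A := A))

theorem OrdSum.nontrivial_left [Nontrivial A] : Nontrivial (OrdSum A B) :=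
  (inl_injective (B := B)).nontrivial

end Summands

/-- Nontriviality of `B₀` passes to all partial sums, so every later summand sits above something
nontrivial and yields `2 + B + 2`. -/
theorem OmitsProhibited.foldl_summands (Bs : List HeytAlg.{u}) (B₀ : HeytAlg.{u})
    [Nontrivial B₀] [hfin : Finite (Bs.foldl ordSum B₀ : HeytAlg.{u})]
    (h : OmitsProhibited (OrdSum (Bs.foldl ordSum B₀ : HeytAlg.{u}) Bool)) :
    (Finite B₀ ∧ OmitsProhibited (OrdSum B₀ Bool)) ∧
      ∀ B ∈ Bs, Finite B ∧ OmitsProhibited (OrdSum Bool (OrdSum B Bool)) := by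
  induction Bs generalizing B₀ with
  | nil => exact ⟨⟨hfin, h⟩, by simp⟩
  | cons B Bs ih =>
    have hnt : Nontrivial (ordSum B₀ B) := OrdSum.nontrivial_left
    obtain ⟨⟨hf, h1⟩, h2⟩ := @ih (ordSum B₀ B) hnt hfin h
    have hf' : Finite (OrdSum B₀ B) := hf
    have h1' : OmitsProhibited (OrdSum (OrdSum B₀ B) Bool) := h1
    refine ⟨⟨OrdSum.finite_left (B := B), h1'.left_add_two⟩, ?_⟩
    intro C hC
    rcases List.mem_cons.1 hC with rfl | hC
    · exact ⟨OrdSum.finite_right (A := B₀), h1'.two_add_right_add_two⟩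
    · exact h2 C hC

/-! ### Cutting at nodes -/

section Split

variable {A : Type u} [HeytingAlgebra A]

/-- A node decomposes an algebra into a sum. -/
noncomputable def IsNode.orderIso {v : A} (hv : IsNode v) :
    A ≃o OrdSum (Set.Iic v) (Set.Ici v) :=
  orderIsoOfSurjective
    (fun x => ⟨(⟨x ⊓ v, inf_le_right⟩, ⟨x ⊔ v, le_sup_right⟩),
      (hv x).imp (fun h => Subtype.ext (inf_of_le_right h))
        (fun h => Subtype.ext (sup_of_le_right h))⟩)
    (fun x y => by
      refine OrdSum.le_def.trans ⟨fun h => ?_, fun h => ?_⟩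
      · exact le_of_inf_le_sup_le h.1 h.2
      · exact ⟨inf_le_inf_right v h, sup_le_sup_right h v⟩)
    (by
      intro z
      induction z using OrdSum.cases_sum with
      | hl a _ => exact ⟨a.1, Subtype.ext (Prod.ext (Subtype.ext (inf_of_le_left a.2))
          (Subtype.ext (sup_of_le_right a.2)))⟩
      | hr b => exact ⟨b.1, Subtype.ext (Prod.ext (Subtype.ext (inf_of_le_right b.2))
          (Subtype.ext (sup_of_le_left b.2)))⟩)

theorem exists_greatest_node [Finite A] [Nontrivial A] :
    ∃ v : A, IsNode v ∧ v ≠ ⊤ ∧ ∀ w : A, IsNode w → w ≠ ⊤ → w ≤ v := by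
  obtain ⟨v, -, hv⟩ := Finite.exists_le_maximal (p := fun v : A => IsNode v ∧ v ≠ ⊤) (a := ⊥)
    ⟨fun b => Or.inl bot_le, bot_ne_top⟩
  refine ⟨v, hv.prop.1, hv.prop.2, fun w hw hwt => ?_⟩
  rcases hw v with h | h
  exacts [h, hv.2 ⟨hw, hwt⟩ h]

/-- A node of the interval above a node `v` is a node of `A`. -/
theorem isNodeless_Ici {v : A} (hv : IsNode v) (hvt : v ≠ ⊤)
    (hmax : ∀ w : A, IsNode w → w ≠ ⊤ → w ≤ v) : IsNodeless (Set.Ici v) := by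
  refine ⟨⟨⊥, ⊤, fun h => hvt (congrArg Subtype.val h)⟩, fun w hw => ?_⟩
  by_cases hwt : w = ⊤
  · exact Or.inr hwt
  refine Or.inl (le_bot_iff.1 (hmax w.1 (fun b => ?_) fun h => hwt (Subtype.ext h)))
  rcases hv b with h | h
  · exact hw ⟨b, h⟩
  · exact Or.inr (h.trans w.2)

/-- A subdirectly irreducible algebra has a greatest element distinct from the top element. -/
theorem IsSubdirectlyIrreducible.exists_coatom (h : IsSubdirectlyIrreducible A) :
    ∃ e : A, e ≠ ⊤ ∧ ∀ x : A, x ≠ ⊤ → x ≤ e := by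
  obtain ⟨-, h⟩ := h
  obtain ⟨a, b, hab, hne⟩ : ∃ a b : A,
      (sInf {θ : Setoid A | IsHeytingCongruence θ ∧ θ ≠ ⊥}) a b ∧ a ≠ b := by
    by_contra! hc
    exact h (le_bot_iff.1 fun a b hab => hc a b hab)
  -- The pair `a`, `b` is identified by every nontrivial congruence. Each `x ≠ ⊤` gives one, the
  -- kernel of meeting with `x`, so `a ⊓ x = b ⊓ x`, which says that `x` is below the biimplication.
  refine ⟨(a ⇨ b) ⊓ (b ⇨ a), fun he => ?_, fun x hx => ?_⟩
  · rw [inf_eq_top_iff, himp_eq_top_iff, himp_eq_top_iff] at he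
    exact hne (le_antisymm he.1 he.2)
  let θ : Setoid A := Setoid.ker (restrictIic x)
  have hθ : IsHeytingCongruence θ := by
    intro a a' b b' ha hb
    have ha' : restrictIic x a = restrictIic x a' := ha
    have hb' : restrictIic x b = restrictIic x b' := hb
    refine ⟨?_, ?_, ?_⟩ <;> refine Setoid.ker_def.2 ?_ <;> simp [ha', hb']
  have hθ' : θ ≠ ⊥ := by
    intro h'
    have h1 : θ x ⊤ := by
      refine Setoid.ker_def.2 (Subtype.ext ?_)
      change x ⊓ x = ⊤ ⊓ x
      simp
    rw [h'] at h1
    exact hx h1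
  have hθab : θ a b := hab θ ⟨hθ, hθ'⟩
  have hx' : a ⊓ x = b ⊓ x := congrArg Subtype.val (Setoid.ker_def.1 hθab)
  refine le_inf (le_himp_iff.2 ?_) (le_himp_iff.2 ?_)
  · rw [inf_comm, hx']
    exact inf_le_left
  · rw [inf_comm, ← hx']
    exact inf_le_left

theorem IsSubdirectlyIrreducible.exists_orderIso (h : IsSubdirectlyIrreducible A) :
    ∃ e : A, Nonempty (A ≃o OrdSum (Set.Iic e) Bool) := by
  classical
  obtain ⟨e, het, he⟩ := h.exists_coatom
  have hnode : IsNode e := fun b => by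
    by_cases hb : b = ⊤
    · exact Or.inl (hb ▸ le_top)
    · exact Or.inr (he b hb)
  have k : Set.Ici e ≃o Bool := orderIsoOfSurjective (fun x => decide (x = ⊤))
    (fun x y => by
      simp only [Bool.le_iff_imp, decide_eq_true_eq]
      refine ⟨fun hxy => ?_, fun hxy hx => top_le_iff.1 (hx ▸ hxy)⟩
      by_cases hx : x = ⊤
      · exact (hxy hx).symm ▸ le_top
      · have hye : e ≤ y.1 := y.2
        exact (he x.1 fun h' => hx (Subtype.ext h')).trans hye)
    (by
      rintro (_ | _)
      · exact ⟨⊥, decide_eq_false fun h' => het (congrArg Subtype.val h')⟩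
      · exact ⟨⊤, decide_eq_true rfl⟩)
  exact ⟨e, ⟨hnode.orderIso.trans (OrdSum.congr (OrderIso.refl _) k)⟩⟩

end Split

/-- Cut at the greatest node `v` below `⊤`. The part above `v` is nodeless and, unless `v = ⊥`, has
a nontrivial part below it, so it is `Z₂` or `Z₄`; the part below `v` is smaller. Only for `v = ⊥`
is the whole algebra nodeless, and only there can `Z₈` occur. -/
theorem OmitsProhibited.exists_decomposition {A : Type u} [HeytingAlgebra A] [Finite A]
    (h : OmitsProhibited (OrdSum A Bool)) :
    ∃ (B₀ : HeytAlg.{0}) (Bs : List HeytAlg.{0}),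
      (B₀ = algZ1 ∨ B₀ = algZ2 ∨ B₀ = algZ4 ∨ B₀ = algZ8) ∧
      (∀ B ∈ Bs, B = algZ2 ∨ B = algZ4) ∧ Nonempty (A ≃o (Bs.foldl ordSum B₀ : HeytAlg.{0})) := by
  obtain ⟨n, hn⟩ : ∃ n, Nat.card A < n := ⟨_, Nat.lt_succ_self _⟩
  induction n generalizing A with
  | zero => exact absurd hn (Nat.not_lt_zero _)
  | succ n ih =>
    rcases subsingleton_or_nontrivial A with hA | hA
    · refine ⟨algZ1, [], Or.inl rfl, by simp, ⟨?_⟩⟩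
      exact orderIsoOfSurjective (Y := PUnit.{1}) (fun _ => PUnit.unit)
        (fun x y => by simp [Subsingleton.elim x y]) fun _ => ⟨⊥, rfl⟩
    obtain ⟨v, hv, hvt, hmax⟩ := exists_greatest_node (A := A)
    by_cases hvb : v = ⊥
    · have hA' : IsNodeless A := by
        refine ⟨hA, fun w hw => ?_⟩
        by_cases hwt : w = ⊤
        · exact Or.inr hwt
        · exact Or.inl (le_bot_iff.1 (hvb ▸ hmax w hw hwt))
      rcases hA'.classify_add_two h with hk | hk | hk
      · exact ⟨algZ2, [], by simp, by simp, hk⟩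
      · exact ⟨algZ4, [], by simp, by simp, hk⟩
      · exact ⟨algZ8, [], by simp, by simp, hk⟩
    have hsplit : OmitsProhibited (OrdSum (OrdSum (Set.Iic v) (Set.Ici v)) Bool) :=
      h.of_orderIso (OrdSum.congr hv.orderIso.symm (OrderIso.refl Bool))
    have hnt : Nontrivial (Set.Iic v) := ⟨⊥, ⊤, fun h' => hvb (congrArg Subtype.val h').symm⟩
    have hcard : Nat.card (Set.Iic v) < Nat.card A :=
      Finite.card_subtype_lt (x := (⊤ : A)) fun h' => hvt (top_le_iff.1 h')
    obtain ⟨B₀, Bs, hB₀, hBs, ⟨k⟩⟩ := ih hsplit.left_add_two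
      (hcard.trans_le (Nat.lt_succ_iff.1 hn))
    have hlast : ∃ B : HeytAlg.{0}, (B = algZ2 ∨ B = algZ4) ∧ Nonempty (Set.Ici v ≃o B) := by
      rcases (isNodeless_Ici hv hvt hmax).classify_two_add hsplit.two_add_right_add_two
        with hk | hk
      exacts [⟨algZ2, Or.inl rfl, hk⟩, ⟨algZ4, Or.inr rfl, hk⟩]
    obtain ⟨B, hB, ⟨l⟩⟩ := hlast
    refine ⟨B₀, Bs ++ [B], hB₀, fun C hC => ?_, ?_⟩
    · rcases List.mem_append.1 hC with hC | hC
      · exact hBs C hC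
      · rw [List.mem_singleton.1 hC]
        exact hB
    · rw [List.foldl_append]
      exact ⟨hv.orderIso.trans (OrdSum.congr k l)⟩

/-! ### Projectivity -/

theorem hasLift_empty {A : Type u} [HeytingAlgebra A] :
    HasLift (OrdSum (LowerSet Empty) Bool) A :=
  hasLift_of_generators fun _ _ _ _ _ _ =>
    ⟨Empty.elim, isPartialHeytingHom_joinOf (fun x => x.elim) (fun x => x.elim), fun x => x.elim⟩

theorem hasLift_algZ2 (A : Type u) [HeytingAlgebra A] : HasLift (OrdSum algZ2 Bool) A :=
  hasLift_unit.of_orderIso (OrdSum.congr lowerSetUnit.symm (OrderIso.refl Bool))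

theorem hasLift_algZ4 (A : Type u) [HeytingAlgebra A] : HasLift (OrdSum algZ4 Bool) A :=
  hasLift_antichainTwo.of_orderIso (OrdSum.congr lowerSetAntichainTwo.symm (OrderIso.refl Bool))

theorem OmitsProhibited.hasLift_base {A : Type u} [HeytingAlgebra A] (hA : OmitsProhibited A)
    {B₀ : HeytAlg.{0}} (h : B₀ = algZ1 ∨ B₀ = algZ2 ∨ B₀ = algZ4 ∨ B₀ = algZ8) :
    HasLift (OrdSum B₀ Bool) A := by
  rcases h with rfl | rfl | rfl | rfl
  · let k : PUnit.{1} ≃o LowerSet Empty :=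
      orderIsoOfSurjective (fun _ => ⊥) (fun x y => by simp)
        fun S => ⟨PUnit.unit, LowerSet.ext (Subsingleton.elim _ _)⟩
    exact hasLift_empty.of_orderIso (OrdSum.congr k (OrderIso.refl Bool))
  · exact hasLift_algZ2 A
  · exact hasLift_algZ4 A
  · exact hA.hasLift_Z8

/-- Properties of `A` enter only through the lowest summand; the others lift into every algebra, as
`HasLift.ordSum` requires. -/
theorem hasLift_foldl {A : Type u} [HeytingAlgebra A] (Bs : List HeytAlg.{0}) (B₀ : HeytAlg.{0})
    (h₀ : HasLift (OrdSum B₀ Bool) A) (hBs : ∀ B ∈ Bs, B = algZ2 ∨ B = algZ4) :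
    HasLift (OrdSum (Bs.foldl ordSum B₀ : HeytAlg.{0}) Bool) A := by
  induction Bs generalizing B₀ with
  | nil => exact h₀
  | cons B Bs ih =>
    refine ih (ordSum B₀ B) ?_ fun C hC => hBs C (List.mem_cons_of_mem _ hC)
    have hB : ∀ (A' : Type u) [HeytingAlgebra A'], HasLift (OrdSum B Bool) A' := by
      rcases hBs B List.mem_cons_self with rfl | rfl
      exacts [hasLift_algZ2, hasLift_algZ4]
    exact (h₀.ordSum hB).of_orderIso OrdSum.assoc

theorem IsProjectiveIn.isWeaklyProjectiveIn {V : Set HeytAlg.{u}} {A : HeytAlg.{u}}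
    (h : IsProjectiveIn V A) : IsWeaklyProjectiveIn V A := by
  refine ⟨h.1, fun B hB ⟨k, hk⟩ => ?_⟩
  obtain ⟨g, hg⟩ := h.2 B hB A h.1 k hk (HeytingHom.id A)
  exact ⟨g, Function.LeftInverse.injective (g := k) fun x => DFunLike.congr_fun hg x⟩

theorem mainTheorem6 (A : HeytAlg.{u}) (hfin : Finite A) (hsi : IsSubdirectlyIrreducible A)
    (hA : A ∈ varietyW.{u}) :
    IsProjectiveIn varietyW.{u} A ∧
    IsWeaklyProjectiveIn varietyW.{u} A ∧
    (∃ (B₀ : HeytAlg.{0}) (Bs : List HeytAlg.{0}),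
      (B₀ = algZ1 ∨ B₀ = algZ2 ∨ B₀ = algZ4 ∨ B₀ = algZ8) ∧
      (∀ B ∈ Bs, B = algZ2 ∨ B = algZ4) ∧
      Nonempty (A ≃o sumAddTwo B₀ Bs)) ∧
    (∀ (B₀ : HeytAlg.{u}) (Bs : List HeytAlg.{u}),
      IsNodeless B₀ → (∀ B ∈ Bs, IsNodeless B) → Nonempty (A ≃o sumAddTwo B₀ Bs) →
      (Nonempty (B₀ ≃o algZ1) ∨ Nonempty (B₀ ≃o algZ2) ∨ Nonempty (B₀ ≃o algZ4) ∨
        Nonempty (B₀ ≃o algZ8)) ∧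
      ∀ B ∈ Bs, Nonempty (B ≃o algZ2) ∨ Nonempty (B ≃o algZ4)) := by
  have hOm := omitsProhibited_of_mem_varietyW hA
  have hdec : ∃ (B₀ : HeytAlg.{0}) (Bs : List HeytAlg.{0}),
      (B₀ = algZ1 ∨ B₀ = algZ2 ∨ B₀ = algZ4 ∨ B₀ = algZ8) ∧
      (∀ B ∈ Bs, B = algZ2 ∨ B = algZ4) ∧ Nonempty (A ≃o sumAddTwo B₀ Bs) := by
    obtain ⟨e, ⟨k⟩⟩ := hsi.exists_orderIso
    obtain ⟨B₀, Bs, hB₀, hBs, ⟨l⟩⟩ := (hOm.of_orderIso k.symm).exists_decomposition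
    exact ⟨B₀, Bs, hB₀, hBs, ⟨k.trans (OrdSum.congr l (OrderIso.refl Bool))⟩⟩
  have hproj : IsProjectiveIn varietyW.{u} A := by
    refine ⟨hA, fun A₁ hA₁ A₂ _ h hs f => ?_⟩
    obtain ⟨B₀, Bs, hB₀, hBs, ⟨k⟩⟩ := hdec
    have hlift : HasLift (OrdSum (Bs.foldl ordSum B₀ : HeytAlg.{0}) Bool) A₁ :=
      hasLift_foldl Bs B₀ ((omitsProhibited_of_mem_varietyW hA₁).hasLift_base hB₀) hBs
    exact hlift.of_orderIso (Q := A) k A₂ h hs f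
  refine ⟨hproj, hproj.isWeaklyProjectiveIn, hdec, ?_⟩
  rintro B₀ Bs hB₀ hBs ⟨k⟩
  have hsum : OmitsProhibited (OrdSum (Bs.foldl ordSum B₀ : HeytAlg.{u}) Bool) :=
    hOm.of_orderIso k.symm
  have hfin' : Finite (OrdSum (Bs.foldl ordSum B₀ : HeytAlg.{u}) Bool) :=
    Finite.of_injective _ k.symm.injective
  have hfin'' : Finite (Bs.foldl ordSum B₀ : HeytAlg.{u}) := OrdSum.finite_left (B := Bool)
  have := hB₀.1
  obtain ⟨⟨hf₀, h₀⟩, hs⟩ := hsum.foldl_summands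
  -- A nodeless algebra is nontrivial by definition, so the alternative `algZ1` does not arise.
  refine ⟨Or.inr (hB₀.classify_add_two h₀), fun B hB => ?_⟩
  obtain ⟨hf, h⟩ := hs B hB
  exact (hBs B hB).classify_two_add h
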